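/- Let $\mathbf{k}$ be a field of characteristic $0$, $n\ge 2$, $N\geq 1$, $\lambda\in\mathbf{k}$. Infinitesimal braids. $\mathcal{T}_n$ is the Lie algebra with generators $t_{ij}$ ($1\le i,j\le n$) and relations $t_{ij}=t_{ji}$, $t_{ii}=0$, $[t_{ij},t_{kl}]=0$ if $\#\{i,j,k,l\}=4$, and $[t_{ij},t_{ik}+t_{kj}]=0$. The symmetric group $\mathfrak{S}_n$ acts by $s\cdot t_{ij}=t_{s(i)s(j)}$, and $\mathfrak{B}_n=\mathbf{k}\mathfrak{S}_n\ltimes \mathsf{U}\mathcal{T}_n$, graded by $\deg t_{ij}=1$, $\deg s=0$. Put $s_i=(i\ i{+}1)$ and $Y_i=\sum_{j<i}t_{ji}$. Associators. $\mathrm{Assoc}_\lambda(\mathbf{k})$ is the set of formal series $\Phi(A,B)$ over $\mathbf{k}$ in two non-commuting variables such that $\Delta(\Phi)=\Phi\hat\otimes\Phi$ (with $A,B$ primitive), $\Phi(B,A)=\Phi(A,B)^{-1}$, $e^{\lambda A}\Phi(C,A)e^{\lambda C}\Phi(B,C)e^{\lambda B}\Phi(A,B)=1$ with $C=-A-B$,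 and, in the completion of $\mathsf{U}\mathcal{T}_4$, $$\Phi(t_{12},t_{23}+t_{24})\Phi(t_{13}+t_{23},t_{34})=\Phi(t_{23},t_{34})\Phi(t_{12}+t_{13},t_{24}+t_{34})\Phi(t_{12},t_{23}).$$ Coefficients. Let $A\subset\mathbf{k}[[h]]$ be a subring containing $\mathbf{k}[h]$ that is a discrete valuation ring with local parameter $h$ and is stable under $f(h)\mapsto f(\alpha h)$ for all $\alpha\in\mathbf{k}^\times$ (for instance $A=\mathbf{k}[[h]]$). Let $K$ be its quotient field (for instance $\mathbf{k}((h))$), and let $\epsilon$ be the automorphism $f(h)\mapsto f(-h)$ of $K$. Lift. Let $\Phi\in\mathrm{Assoc}_\lambda(\mathbf{k})$, let $\rho:\mathfrak{B}_n\to M_N(\mathbf{k})$ be a representation, and suppose that for $1\le i<n$ the matrices $$\Phi\bigl(h\rho(t_{i,i+1}),h\rho(Y_i)\bigr)\,\rho(s_i)\,e^{\lambda h\rho(t_{i,i+1})}\,\Phi\bigl(h\rho(Y_i),h\rho(t_{i,i+1})\bigr)\in M_N(\mathbf{k}[[h]])$$ have coefficients in $A$ (automatic for $A=\mathbf{k}[[h]]$).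 $\widehat\Phi(\rho)$ denotes the representation of the braid group $B_n$ over $A$ that sends each Artin generator $\sigma_i$ to this matrix. Forms. For a non-degenerate bilinear form $\beta$ on $L^N$, $L$ a field, let $x^\dagger$ be the transpose of $x\in M_N(L)$: $\beta(xu,v)=\beta(u,x^\dagger v)$. The group $\{x\in GL_N(L): x^\dagger x=1\}$ is denoted $O_N(L,\beta)$ if $\beta$ is symmetric and $SP_N(L,\beta)$ if $\beta$ is skew-symmetric. For a field automorphism $\epsilon$ of $L$, acting coefficientwise on matrices, and $\beta$ symmetric, $U_N^\epsilon(L,\beta)=\{x\in GL_N(L):\epsilon(x^\dagger)=x^{-1}\}$. A non-degenerate form $\beta$ on $\mathbf{k}^N$ is extended to $K^N$ with the same Gram matrix. **Proposition.** There is one and only one homomorphism $\widehat\Phi(\rho):B_n\to GL_N(A)$ with the prescribed values on the $\sigma_i$. Let $\beta$ be a non-degenerate bilinear form on $\mathbf{k}^N$ such that every $\rho(s)$, $s\in\mathfrak{S}_n$, is an isometry: $\rho(s)^\dagger\rho(s)=1$. 1. If $\beta$ is symmetric and $\rho(t_{12})^\dagger=-\rho(t_{12})$ ($\rho$ is orthogonal),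 then $\widehat\Phi(\rho)$ takes values in $O_N(K,\beta)$. 2. If $\beta$ is skew-symmetric and $\rho(t_{12})^\dagger=-\rho(t_{12})$ ($\rho$ is symplectic), then $\widehat\Phi(\rho)$ takes values in $SP_N(K,\beta)$. 3. If $\beta$ is symmetric and $\rho(t_{12})^\dagger=\rho(t_{12})$ ($\rho$ is unitary), then $\widehat\Phi(\rho)$ takes values in $U_N^\epsilon(K,\beta)$. -/

import Mathlib

open scoped PowerSeries

/-! ### Braids and infinitesimal braids -/

/-- Defining relators of the braid group on `n` strands, in the free group on
`σ_0, …, σ_{n-2}` (numbering from `0`). -/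
def braidRelators (n : ℕ) : Set (FreeGroup (Fin (n - 1))) :=
  {r | ∃ i j : Fin (n - 1), (i : ℕ) + 1 = j ∧
      r = FreeGroup.of i * FreeGroup.of j * FreeGroup.of i *
        (FreeGroup.of j * FreeGroup.of i * FreeGroup.of j)⁻¹} ∪
  {r | ∃ i j : Fin (n - 1), (i : ℕ) + 2 ≤ j ∧
      r = FreeGroup.of i * FreeGroup.of j * (FreeGroup.of j * FreeGroup.of i)⁻¹}

/-- The braid group `B_n`. -/
abbrev BraidGroup (n : ℕ) : Type := PresentedGroup (braidRelators n)

/-- The Artin generator `σ_i`, crossing the strands `i` and `i + 1` (numbered from `0`). -/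
def BraidGroup.sigma {n : ℕ} (i : Fin (n - 1)) : BraidGroup n := PresentedGroup.of i

/-- The strand `i`, seen among all `n` strands. -/
def strandLeft {n : ℕ} (i : Fin (n - 1)) : Fin n := ⟨i, by omega⟩

/-- The strand `i + 1`, seen among all `n` strands. -/
def strandRight {n : ℕ} (i : Fin (n - 1)) : Fin n := ⟨i + 1, by omega⟩

section Infinitesimal

variable (k : Type*) [CommRing k] (n : ℕ)

/-- Defining relations of the enveloping algebra of the Lie algebra of infinitesimal pure braids:
the brackets of the Lie algebra are written as commutators. -/
inductive PureInfBraidRel : FreeAlgebra k (Fin n × Fin n) → FreeAlgebra k (Fin n × Fin n) → Prop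
  | symm (i j : Fin n) : PureInfBraidRel (FreeAlgebra.ι k (i, j)) (FreeAlgebra.ι k (j, i))
  | diag (i : Fin n) : PureInfBraidRel (FreeAlgebra.ι k (i, i)) 0
  | comm (i j l m : Fin n) (hij : i ≠ j) (hil : i ≠ l) (him : i ≠ m) (hjl : j ≠ l) (hjm : j ≠ m)
      (hlm : l ≠ m) :
      PureInfBraidRel (FreeAlgebra.ι k (i, j) * FreeAlgebra.ι k (l, m))
        (FreeAlgebra.ι k (l, m) * FreeAlgebra.ι k (i, j))
  | four (i j l : Fin n) :
      PureInfBraidRel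
        (FreeAlgebra.ι k (i, j) * (FreeAlgebra.ι k (i, l) + FreeAlgebra.ι k (l, j)))
        ((FreeAlgebra.ι k (i, l) + FreeAlgebra.ι k (l, j)) * FreeAlgebra.ι k (i, j))

/-- `U 𝒯_n`, with scalars in `k`: the enveloping algebra of the Lie algebra `𝒯_n` of infinitesimal
pure braids, i.e. the associative algebra presented by the generators `t_{ij}` and the defining
relations of `𝒯_n`. -/
abbrev PureInfBraid := RingQuot (PureInfBraidRel k n)

variable {n} in
/-- The generator `t_{ij}` of `U 𝒯_n`. -/
def PureInfBraid.t (i j : Fin n) : PureInfBraid k n :=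
  RingQuot.mkAlgHom k (PureInfBraidRel k n) (FreeAlgebra.ι k (i, j))

/-- Defining relations of the semidirect product `𝔅_n` of `k 𝔖_n` and `U 𝒯_n`, on the generators
`s ∈ 𝔖_n` and `t_{ij}`. -/
inductive InfBraidRel : FreeAlgebra k (Equiv.Perm (Fin n) ⊕ Fin n × Fin n) →
    FreeAlgebra k (Equiv.Perm (Fin n) ⊕ Fin n × Fin n) → Prop
  | perm_one : InfBraidRel (FreeAlgebra.ι k (Sum.inl 1)) 1
  | perm_mul (s s' : Equiv.Perm (Fin n)) :
      InfBraidRel (FreeAlgebra.ι k (Sum.inl (s * s')))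
        (FreeAlgebra.ι k (Sum.inl s) * FreeAlgebra.ι k (Sum.inl s'))
  | act (s : Equiv.Perm (Fin n)) (i j : Fin n) :
      InfBraidRel (FreeAlgebra.ι k (Sum.inl s) * FreeAlgebra.ι k (Sum.inr (i, j)))
        (FreeAlgebra.ι k (Sum.inr (s i, s j)) * FreeAlgebra.ι k (Sum.inl s))
  | pure (a b : FreeAlgebra k (Fin n × Fin n)) (hab : PureInfBraidRel k n a b) :
      InfBraidRel (FreeAlgebra.lift k (fun p => FreeAlgebra.ι k (Sum.inr p)) a)
        (FreeAlgebra.lift k (fun p => FreeAlgebra.ι k (Sum.inr p)) b)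

/-- The algebra `𝔅_n = k 𝔖_n ⋉ U 𝒯_n` of infinitesimal braids, with scalars in `k`. -/
abbrev InfBraid := RingQuot (InfBraidRel k n)

variable {n} in
/-- The element of `𝔅_n` given by a permutation. -/
def InfBraid.perm (s : Equiv.Perm (Fin n)) : InfBraid k n :=
  RingQuot.mkAlgHom k (InfBraidRel k n) (FreeAlgebra.ι k (Sum.inl s))

variable {n} in
/-- The generator `t_{ij}` of `𝔅_n`. -/
def InfBraid.t (i j : Fin n) : InfBraid k n :=
  RingQuot.mkAlgHom k (InfBraidRel k n) (FreeAlgebra.ι k (Sum.inr (i, j)))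

variable {n} in
/-- `Y_r = ∑_{j < r} t_{j r}`. -/
def InfBraid.Y (r : Fin n) : InfBraid k n :=
  ∑ j ∈ Finset.univ.filter (fun j => j < r), InfBraid.t k j r

end Infinitesimal

/-! ### Associators

The completion `∏_d R_d` of a graded algebra `R = ⨁_d R_d` is viewed inside `R⟦h⟧` through
`∑_d a_d ↦ ∑_d a_d h^d`. Every series below is evaluated at elements of degree one, so its
component of degree `d` is the coefficient of `h^d`, and equations in the completion are equations
in `R⟦h⟧`. -/

/-- Formal series in two non-commuting variables `A` (letter `0`) and `B` (letter `1`):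
the family of coefficients of the words. -/
abbrev NCSeries (k : Type*) := List (Fin 2) → k

/-- `Φ(h x, h y) ∈ R⟦h⟧`. -/
def NCSeries.eval {k R : Type*} [CommRing k] [Ring R] [Algebra k R]
    (Φ : NCSeries k) (x y : R) : R⟦X⟧ :=
  PowerSeries.mk fun d =>
    ∑ w : Fin d → Fin 2, Φ (List.ofFn w) • (List.ofFn fun i => (![x, y] : Fin 2 → R) (w i)).prod

/-- `exp(h x) ∈ R⟦h⟧`. -/
noncomputable def hExp (k : Type*) {R : Type*} [Field k] [Ring R] [Algebra k R] (x : R) : R⟦X⟧ :=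
  PowerSeries.mk fun d => ((d.factorial : k)⁻¹) • x ^ d

section Associator

variable {k : Type*} [Field k]

/-- The variable `A`. -/
def ncA (k : Type*) [Field k] : FreeAlgebra k (Fin 2) := FreeAlgebra.ι k 0

/-- The variable `B`. -/
def ncB (k : Type*) [Field k] : FreeAlgebra k (Fin 2) := FreeAlgebra.ι k 1

/-- The variable `C = - A - B`. -/
def ncC (k : Type*) [Field k] : FreeAlgebra k (Fin 2) := -ncA k - ncB k

open scoped TensorProduct in
/-- `Φ ∈ Assoc_c(k)`. -/
structure IsAssociator (c : k) (Φ : NCSeries k) : Prop where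
  /-- `Δ(Φ) = Φ ⊗ Φ`, where `A` and `B` are primitive for `Δ`. -/
  grouplike :
    Φ.eval (ncA k ⊗ₜ[k] 1 + 1 ⊗ₜ[k] ncA k : FreeAlgebra k (Fin 2) ⊗[k] FreeAlgebra k (Fin 2))
        (ncB k ⊗ₜ[k] 1 + 1 ⊗ₜ[k] ncB k) =
      Φ.eval (ncA k ⊗ₜ[k] 1) (ncB k ⊗ₜ[k] 1) * Φ.eval (1 ⊗ₜ[k] ncA k) (1 ⊗ₜ[k] ncB k)
  /-- `Φ(B, A) = Φ(A, B)⁻¹`. -/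
  inverse :
    Φ.eval (ncB k) (ncA k) * Φ.eval (ncA k) (ncB k) = 1 ∧
      Φ.eval (ncA k) (ncB k) * Φ.eval (ncB k) (ncA k) = 1
  /-- The hexagonal relation. -/
  hexagon :
    hExp k (c • ncA k) * Φ.eval (ncC k) (ncA k) * hExp k (c • ncC k) * Φ.eval (ncB k) (ncC k) *
      hExp k (c • ncB k) * Φ.eval (ncA k) (ncB k) = 1
  /-- The pentagonal relation, in the completion of `U 𝒯_4`; strands are numbered from `0`. -/
  pentagon :
    Φ.eval (PureInfBraid.t k (0 : Fin 4) 1) (PureInfBraid.t k 1 2 + PureInfBraid.t k 1 3) *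
        Φ.eval (PureInfBraid.t k (0 : Fin 4) 2 + PureInfBraid.t k 1 2) (PureInfBraid.t k 2 3) =
      Φ.eval (PureInfBraid.t k (1 : Fin 4) 2) (PureInfBraid.t k 2 3) *
        Φ.eval (PureInfBraid.t k (0 : Fin 4) 1 + PureInfBraid.t k 0 2)
          (PureInfBraid.t k 1 3 + PureInfBraid.t k 2 3) *
        Φ.eval (PureInfBraid.t k (0 : Fin 4) 1) (PureInfBraid.t k 1 2)

/-! ### The lift of a representation of `𝔅_n` to a representation of `B_n` -/

/-- The image `Φ(t_{i,i+1}, Y_i) s_i exp(c t_{i,i+1}) Φ(Y_i, t_{i,i+1})` of `σ_i` in the completion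
of `𝔅_n`. -/
noncomputable def drinfeldElement {n : ℕ} (c : k) (Φ : NCSeries k) (i : Fin (n - 1)) :
    (InfBraid k n)⟦X⟧ :=
  Φ.eval (InfBraid.t k (strandLeft i) (strandRight i)) (InfBraid.Y k (strandLeft i)) *
    PowerSeries.C (InfBraid.perm k (Equiv.swap (strandLeft i) (strandRight i))) *
    hExp k (c • InfBraid.t k (strandLeft i) (strandRight i)) *
    Φ.eval (InfBraid.Y k (strandLeft i)) (InfBraid.t k (strandLeft i) (strandRight i))

/-- A power series with matrix coefficients, seen as a matrix of power series. -/
noncomputable def seriesMatrix {N : ℕ} (f : (Matrix (Fin N) (Fin N) k)⟦X⟧) : Matrix (Fin N) (Fin N) k⟦X⟧ :=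
  Matrix.of fun a b => PowerSeries.mk fun d => PowerSeries.coeff d f a b

/-- The matrix of `σ_i` in the lift of `ρ`: the image of `drinfeldElement` under the extension of
`ρ` to the completion of `𝔅_n` that sends `t_{ij}` to `h ρ(t_{ij})`. -/
noncomputable def drinfeldMatrix {n N : ℕ} (c : k) (Φ : NCSeries k)
    (ρ : InfBraid k n →ₐ[k] Matrix (Fin N) (Fin N) k) (i : Fin (n - 1)) :
    Matrix (Fin N) (Fin N) k⟦X⟧ :=
  seriesMatrix (PowerSeries.map (ρ : InfBraid k n →+* Matrix (Fin N) (Fin N) k)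
    (drinfeldElement c Φ i))

/-- A discrete valuation subring of `k⟦h⟧`: a subring containing `k[h]` that is a discrete valuation
ring with local parameter `h`, stable under `f(h) ↦ f(a h)` for `a ∈ kˣ`. -/
structure IsDiscreteValuationSubring (A : Subalgebra k k⟦X⟧) : Prop where
  X_mem : (PowerSeries.X : k⟦X⟧) ∈ A
  isDVR : IsDiscreteValuationRing A
  irreducible_X : Irreducible (⟨PowerSeries.X, X_mem⟩ : A)
  rescale_mem : ∀ (a : kˣ) (f : k⟦X⟧), f ∈ A → PowerSeries.rescale (a : k) f ∈ A

/-- `R` is the lift of `ρ` over `A`: its values at the Artin generators are the prescribed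
matrices. -/
def IsDrinfeldLift {n N : ℕ} {A : Subalgebra k k⟦X⟧} (c : k) (Φ : NCSeries k)
    (ρ : InfBraid k n →ₐ[k] Matrix (Fin N) (Fin N) k)
    (R : BraidGroup n →* Matrix.GeneralLinearGroup (Fin N) A) : Prop :=
  ∀ i : Fin (n - 1), (R (BraidGroup.sigma i)).1.map (fun f : A => (f : k⟦X⟧)) =
    drinfeldMatrix c Φ ρ i

end Associator

/-! ### The automorphism `f(h) ↦ f(-h)` -/

section Epsilon

variable {k : Type*} [Field k] {A : Subalgebra k k⟦X⟧}

theorem IsDiscreteValuationSubring.rescale_neg_one_mem (hA : IsDiscreteValuationSubring A)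
    (f : k⟦X⟧) (hf : f ∈ A) : PowerSeries.rescale (-1 : k) f ∈ A := by
  simpa using hA.rescale_mem (-1) f hf

/-- `f(h) ↦ f(-h)` on `A`. -/
noncomputable def epsilonSubring (hA : IsDiscreteValuationSubring A) : A ≃+* A :=
  let φ : A →+* A :=
    ((PowerSeries.rescale (-1 : k)).comp A.val.toRingHom).codRestrict A
      fun f => hA.rescale_neg_one_mem f.1 f.2
  have hφ : φ.comp φ = RingHom.id A := by
    ext f
    simp [φ, PowerSeries.rescale_rescale]
  RingEquiv.ofRingHom φ φ hφ hφ

/-- `f(h) ↦ f(-h)` on the quotient field `K` of `A`. -/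
noncomputable def epsilonField (hA : IsDiscreteValuationSubring A) (K : Type*) [Field K]
    [Algebra A K] [IsFractionRing A K] : K ≃+* K :=
  IsFractionRing.ringEquivOfRingEquiv (epsilonSubring hA)

end Epsilon

/-! ### Bilinear forms, transposes and isometries -/

section Forms

variable {L : Type*} [Field L] {N : ℕ}

/-- The transpose `x†` of a matrix `x` with respect to a non-degenerate bilinear form `β`, in terms
of the Gram matrix of `β`. It is characterized by `β(x u, v) = β(u, x† v)`, see
`apply_mulVec_eq_formTranspose`. -/
noncomputable def formTranspose (β : LinearMap.BilinForm L (Fin N → L))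
    (x : Matrix (Fin N) (Fin N) L) : Matrix (Fin N) (Fin N) L :=
  (LinearMap.BilinForm.toMatrix' β)⁻¹ * x.transpose * LinearMap.BilinForm.toMatrix' β

theorem apply_mulVec_eq_formTranspose (β : LinearMap.BilinForm L (Fin N → L))
    (hβ : β.Nondegenerate) (x : Matrix (Fin N) (Fin N) L) (u v : Fin N → L) :
    β (x.mulVec u) v = β u ((formTranspose β x).mulVec v) := by
  have key : ∀ u v, β u v = u ⬝ᵥ (LinearMap.BilinForm.toMatrix' β).mulVec v := fun u v => by
    rw [← Matrix.toBilin'_apply', Matrix.toBilin'_toMatrix']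
  have hdet : IsUnit (LinearMap.BilinForm.toMatrix' β).det :=
    isUnit_iff_ne_zero.mpr <| Matrix.nondegenerate_iff_det_ne_zero.mp <|
      LinearMap.BilinForm.nondegenerate_toMatrix'_iff.mpr hβ
  rw [key, key, formTranspose, Matrix.mulVec_mulVec, ← Matrix.mul_assoc, ← Matrix.mul_assoc,
    Matrix.mul_nonsing_inv _ hdet, Matrix.one_mul, ← Matrix.mulVec_mulVec,
    Matrix.dotProduct_mulVec u, Matrix.vecMul_transpose]

/-- The extension of a bilinear form on `L^N` to a bilinear form on `L'^N`, with the same Gram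
matrix. -/
noncomputable def extendForm {L' : Type*} [Field L'] (f : L →+* L')
    (β : LinearMap.BilinForm L (Fin N → L)) : LinearMap.BilinForm L' (Fin N → L') :=
  Matrix.toBilin' ((LinearMap.BilinForm.toMatrix' β).map f)

/-- The isometries `{x ∈ GL_N(L) | x† x = 1}` of `β`. This is `O_N(L, β)` when `β` is symmetric and
`SP_N(L, β)` when `β` is skew-symmetric. -/
def isometries (β : LinearMap.BilinForm L (Fin N → L)) :
    Set (Matrix.GeneralLinearGroup (Fin N) L) :=
  {x | formTranspose β x.1 * x.1 = 1}

/-- `U_N^ε(L, β) = {x ∈ GL_N(L) | ε x† = x⁻¹}`, where `ε` acts coefficientwise. -/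
def formalUnitaryGroup (ε : L ≃+* L) (β : LinearMap.BilinForm L (Fin N → L)) :
    Set (Matrix.GeneralLinearGroup (Fin N) L) :=
  {x | (formTranspose β x.1).map ε = (x⁻¹).1}

end Forms

/-! ### Orthogonal, symplectic and unitary representations of `𝔅_n` -/

section Infinitesimal

variable {k : Type*} [Field k] {n N : ℕ}

/-- `ρ(𝔖_n)` consists of isometries of `β`, i.e. of matrices `x` with `x† x = 1`. -/
def PermActsByIsometries (β : LinearMap.BilinForm k (Fin N → k))
    (ρ : InfBraid k n →ₐ[k] Matrix (Fin N) (Fin N) k) : Prop :=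
  ∀ s : Equiv.Perm (Fin n),
    formTranspose β (ρ (InfBraid.perm k s)) * ρ (InfBraid.perm k s) = 1

/-- The generator `t_{12}` (the first two strands) of `𝔅_n`, for `n ≥ 2`. -/
def InfBraid.t12 (k : Type*) [Field k] (hn : 2 ≤ n) : InfBraid k n :=
  InfBraid.t k ⟨0, by omega⟩ ⟨1, by omega⟩

/-- `ρ` is orthogonal with respect to `β`. -/
structure IsOrthogonalRep (hn : 2 ≤ n) (β : LinearMap.BilinForm k (Fin N → k))
    (ρ : InfBraid k n →ₐ[k] Matrix (Fin N) (Fin N) k) : Prop where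
  nondegenerate : β.Nondegenerate
  symm : ∀ u v, β u v = β v u
  t12 : formTranspose β (ρ (InfBraid.t12 k hn)) = -ρ (InfBraid.t12 k hn)
  perm : PermActsByIsometries β ρ

/-- `ρ` is symplectic with respect to `β`. -/
structure IsSymplecticRep (hn : 2 ≤ n) (β : LinearMap.BilinForm k (Fin N → k))
    (ρ : InfBraid k n →ₐ[k] Matrix (Fin N) (Fin N) k) : Prop where
  nondegenerate : β.Nondegenerate
  skew : ∀ u v, β u v = -β v u
  t12 : formTranspose β (ρ (InfBraid.t12 k hn)) = -ρ (InfBraid.t12 k hn)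
  perm : PermActsByIsometries β ρ

/-- `ρ` is unitary with respect to `β`. -/
structure IsUnitaryRep (hn : 2 ≤ n) (β : LinearMap.BilinForm k (Fin N → k))
    (ρ : InfBraid k n →ₐ[k] Matrix (Fin N) (Fin N) k) : Prop where
  nondegenerate : β.Nondegenerate
  symm : ∀ u v, β u v = β v u
  t12 : formTranspose β (ρ (InfBraid.t12 k hn)) = ρ (InfBraid.t12 k hn)
  perm : PermActsByIsometries β ρ

end Infinitesimal

/-! ### Power series with non-commutative coefficients -/

section Series

variable {R S : Type*} [Ring R] [Ring S]

/-! Two facts about associators carry the theorem: Drinfeld's elements satisfy the braid relations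
in `𝔅_n⟦h⟧`, and a group-like series is inverted by the antipode.

Braid relations. Elements attached to distant generators commute because their ingredients do
(`drinfeldElement_commute`). For adjacent generators, the strands to the left are fused into one
strand (`InfBraid.exists_cabling`), so that the pentagon holds with `Y_i` as an argument. The
pentagon exhibits both elements as conjugates, by one common series, of simpler elements that
involve three strands only (`braid_four`); for these the braid relation is the hexagon combined with
`s s' s = s' s s'` (`braid_three`). The hexagon is needed for three elements whose sum is central,
not zero; group-likeness and the normalization `Φ(x, 0) = 1` allow this shift (`hexagon_central`).
Invertibility over `A` comes from `A` being local with parameter `h`.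

Isometries. Let an anti-endomorphism `τ` of the matrix algebra act on series with `h` sent to `δ h`.
If every `h t_{ij}` becomes its opposite, then `τ` acts on `Φ(h t, h Y)`, `Φ(h Y, h t)` and `exp(c h
t)` as the antipode does, hence inverts them; it also inverts the permutations. So it inverts the
image of each Artin generator (`antiSeries_map_drinfeldElement_mul`). Here `τ` is the transpose for
`β`, with `δ = 1` in the orthogonal and symplectic cases and `δ = -1` in the unitary case.
Conjugation by permutations extends skewness from `t_{12}` to all `t_{ij}`, and the identity of Gram
matrices spreads from the generators to the whole group. -/

theorem PowerSeries.commute_of_coeff {f g : R⟦X⟧}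
    (h : ∀ i j, Commute (PowerSeries.coeff i f) (PowerSeries.coeff j g)) : Commute f g := by
  ext d
  rw [PowerSeries.coeff_mul, PowerSeries.coeff_mul, ← Finset.Nat.sum_antidiagonal_swap]
  exact Finset.sum_congr rfl fun p _ => h _ _

theorem PowerSeries.semiconjBy_C {f g : R⟦X⟧} {u : R}
    (h : ∀ d, SemiconjBy u (PowerSeries.coeff d f) (PowerSeries.coeff d g)) :
    SemiconjBy (PowerSeries.C u) f g := by
  ext d
  rw [PowerSeries.coeff_C_mul, PowerSeries.coeff_mul_C]
  exact h d

end Series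

/-! ### Values of a two-variable series: naturality, homogeneity, intertwining -/

section Eval

variable {k R S : Type*} [CommRing k] [Ring R] [Algebra k R] [Ring S] [Algebra k S]
  (Φ : NCSeries k)

theorem NCSeries.coeff_eval (x y : R) (d : ℕ) :
    PowerSeries.coeff d (Φ.eval x y) = ∑ w : Fin d → Fin 2,
      Φ (List.ofFn w) • (List.ofFn fun i => (![x, y] : Fin 2 → R) (w i)).prod :=
  PowerSeries.coeff_mk _ _

theorem NCSeries.coeff_eval_map (f : R →ₐ[k] S) (x y : R) (d : ℕ) :
    PowerSeries.coeff d (Φ.eval (f x) (f y)) = f (PowerSeries.coeff d (Φ.eval x y)) := by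
  have h : (![f x, f y] : Fin 2 → S) = f ∘ ![x, y] := by
    ext i; fin_cases i <;> rfl
  simp only [coeff_eval, map_sum, map_smul, map_list_prod, List.map_ofFn, h]
  rfl

theorem NCSeries.map_eval (f : R →ₐ[k] S) (x y : R) :
    PowerSeries.map (f : R →+* S) (Φ.eval x y) = Φ.eval (f x) (f y) := by
  ext d
  rw [PowerSeries.coeff_map, Φ.coeff_eval_map]
  rfl

/-- Words of length `d` are homogeneous of degree `d`. This is how the substitution `h ↦ δ h` gets
absorbed into the arguments. -/
theorem NCSeries.coeff_eval_smul (δ : k) (x y : R) (d : ℕ) :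
    PowerSeries.coeff d (Φ.eval (δ • x) (δ • y)) = δ ^ d • PowerSeries.coeff d (Φ.eval x y) := by
  have h : (![δ • x, δ • y] : Fin 2 → R) = δ • ![x, y] := by
    ext i; fin_cases i <;> rfl
  have key : ∀ (d : ℕ) (v : Fin d → R),
      (List.ofFn fun i => δ • v i).prod = δ ^ d • (List.ofFn v).prod := by
    intro d
    induction d with
    | zero => simp
    | succ d ih =>
      intro v
      rw [List.ofFn_succ, List.ofFn_succ, List.prod_cons, List.prod_cons, ih,
        smul_mul_smul_comm, pow_succ']
  rw [coeff_eval, coeff_eval, Finset.smul_sum, h]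
  refine Finset.sum_congr rfl fun w _ => ?_
  simp only [Pi.smul_apply]
  rw [key, smul_comm]

/-- An intertwining relation passes through words letter by letter. The semiconjugation form needs
no inverse of `u` and covers both the action of a permutation and plain commutation. -/
theorem NCSeries.semiconjBy_coeff_eval {u x y x' y' : R} (hx : SemiconjBy u x x')
    (hy : SemiconjBy u y y') (d : ℕ) :
    SemiconjBy u (PowerSeries.coeff d (Φ.eval x y)) (PowerSeries.coeff d (Φ.eval x' y')) := by
  have key : ∀ (d : ℕ) (v v' : Fin d → R), (∀ i, SemiconjBy u (v i) (v' i)) →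
      SemiconjBy u (List.ofFn v).prod (List.ofFn v').prod := by
    intro d
    induction d with
    | zero => intro v v' _; simp
    | succ d ih =>
      intro v v' h
      rw [List.ofFn_succ, List.ofFn_succ, List.prod_cons, List.prod_cons]
      exact (h 0).mul_right (ih _ _ fun i => h i.succ)
  have hxy : ∀ i, SemiconjBy u ((![x, y] : Fin 2 → R) i) ((![x', y'] : Fin 2 → R) i) := by
    intro i; fin_cases i
    exacts [hx, hy]
  rw [coeff_eval, coeff_eval, SemiconjBy, Finset.mul_sum, Finset.sum_mul]
  refine Finset.sum_congr rfl fun w _ => ?_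
  rw [mul_smul_comm, smul_mul_assoc]
  exact congrArg _ (key d _ _ fun i => hxy _)

theorem NCSeries.semiconjBy_C_eval {u x y x' y' : R} (hx : SemiconjBy u x x')
    (hy : SemiconjBy u y y') : SemiconjBy (PowerSeries.C u) (Φ.eval x y) (Φ.eval x' y') :=
  PowerSeries.semiconjBy_C (Φ.semiconjBy_coeff_eval hx hy)

theorem NCSeries.commute_coeff_eval {u x y : R} (hx : Commute u x) (hy : Commute u y) (d : ℕ) :
    Commute u (PowerSeries.coeff d (Φ.eval x y)) :=
  Φ.semiconjBy_coeff_eval hx hy d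

end Eval

/-! ### The exponential series -/

section HExp

variable {k R S : Type*} [Field k] [Ring R] [Algebra k R] [Ring S] [Algebra k S]

theorem coeff_hExp (x : R) (d : ℕ) :
    PowerSeries.coeff d (hExp k x) = ((d.factorial : k)⁻¹) • x ^ d :=
  PowerSeries.coeff_mk _ _

theorem map_hExp (f : R →ₐ[k] S) (x : R) :
    PowerSeries.map (f : R →+* S) (hExp k x) = hExp k (f x) := by
  ext d
  simp [coeff_hExp]

theorem hExp_zero : hExp k (0 : R) = 1 := by
  ext d
  rcases d with _ | d <;> simp [coeff_hExp, PowerSeries.coeff_one]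

theorem hExp_add [CharZero k] {x y : R} (h : Commute x y) :
    hExp k (x + y) = hExp k x * hExp k y := by
  ext d
  rw [PowerSeries.coeff_mul, coeff_hExp, h.add_pow', Finset.smul_sum]
  refine Finset.sum_congr rfl fun p hp => ?_
  rw [coeff_hExp, coeff_hExp, smul_mul_smul_comm, ← Nat.cast_smul_eq_nsmul k, smul_smul]
  congr 1
  rw [Finset.HasAntidiagonal.mem_antidiagonal] at hp
  have h₁ : ((d.choose p.1 : ℕ) : k) * (p.1.factorial * p.2.factorial) = d.factorial := by
    rw [← hp, Nat.choose_symm_add, ← Nat.add_choose_mul_factorial_mul_factorial p.1 p.2]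
    push_cast
    ring
  have h₂ : (p.1.factorial : k) ≠ 0 := by exact_mod_cast p.1.factorial_ne_zero
  have h₃ : (p.2.factorial : k) ≠ 0 := by exact_mod_cast p.2.factorial_ne_zero
  have h₄ : (d.factorial : k) ≠ 0 := by exact_mod_cast d.factorial_ne_zero
  field_simp
  rw [← h₁]
  ring

theorem hExp_neg_mul_self [CharZero k] (x : R) : hExp k (-x) * hExp k x = 1 := by
  rw [← hExp_add (Commute.refl x).neg_left, neg_add_cancel, hExp_zero]

theorem hExp_mul_neg_self [CharZero k] (x : R) : hExp k x * hExp k (-x) = 1 := by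
  rw [← hExp_add (Commute.refl x).neg_right, add_neg_cancel, hExp_zero]

theorem semiconjBy_coeff_hExp {u x x' : R} (h : SemiconjBy u x x') (d : ℕ) :
    SemiconjBy u (PowerSeries.coeff d (hExp k x)) (PowerSeries.coeff d (hExp k x')) := by
  rw [coeff_hExp, coeff_hExp, SemiconjBy, mul_smul_comm, smul_mul_assoc]
  exact congrArg _ (h.pow_right d)

theorem semiconjBy_C_hExp {u x x' : R} (h : SemiconjBy u x x') :
    SemiconjBy (PowerSeries.C u) (hExp k x) (hExp k x') :=
  PowerSeries.semiconjBy_C (semiconjBy_coeff_hExp h)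

theorem commute_hExp_hExp {x y : R} (h : Commute x y) : Commute (hExp k x) (hExp k y) :=
  PowerSeries.commute_of_coeff fun i j =>
    semiconjBy_coeff_hExp (Commute.symm (semiconjBy_coeff_hExp (k := k) h.symm i)) j

theorem commute_hExp_eval (Φ : NCSeries k) {u x y : R} (hx : Commute u x) (hy : Commute u y) :
    Commute (hExp k u) (Φ.eval x y) :=
  PowerSeries.commute_of_coeff fun i j => Φ.commute_coeff_eval
    (Commute.symm (semiconjBy_coeff_hExp (k := k) hx.symm i))
    (Commute.symm (semiconjBy_coeff_hExp (k := k) hy.symm i)) j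

end HExp

/-! ### Consequences of the defining relations of associators -/

section PureInfBraidLift

variable {k R : Type*} [CommRing k] [Ring R] [Algebra k R] {n : ℕ}

theorem PureInfBraid.exists_lift (t : Fin n → Fin n → R) (symm : ∀ i j, t i j = t j i)
    (diag : ∀ i, t i i = 0)
    (comm : ∀ i j l m, i ≠ j → i ≠ l → i ≠ m → j ≠ l → j ≠ m → l ≠ m → Commute (t i j) (t l m))
    (four : ∀ i j l, Commute (t i j) (t i l + t l j)) :
    ∃ f : PureInfBraid k n →ₐ[k] R, ∀ i j, f (PureInfBraid.t k i j) = t i j := by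
  refine ⟨RingQuot.liftAlgHom k ⟨FreeAlgebra.lift k fun p => t p.1 p.2, ?_⟩, fun i j => ?_⟩
  · intro a b h
    induction h with
    | symm i j => simpa using symm i j
    | diag i => simpa using diag i
    | comm i j l m h₁ h₂ h₃ h₄ h₅ h₆ => simpa using (comm i j l m h₁ h₂ h₃ h₄ h₅ h₆).eq
    | four i j l => simpa using (four i j l).eq
  · rw [PureInfBraid.t, RingQuot.liftAlgHom_mkAlgHom_apply, FreeAlgebra.lift_ι_apply]

end PureInfBraidLift

theorem FreeAlgebra.commute_lift {k R X : Type*} [CommRing k] [Ring R] [Algebra k R] {u : R}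
    {v : X → R} (h : ∀ i, Commute u (v i)) (a : FreeAlgebra k X) :
    Commute u (FreeAlgebra.lift k v a) := by
  induction a using FreeAlgebra.induction with
  | grade0 r => rw [AlgHom.commutes]; exact (Algebra.commutes r u).symm
  | grade1 i => rw [FreeAlgebra.lift_ι_apply]; exact h i
  | mul a b ha hb => rw [map_mul]; exact ha.mul_right hb
  | add a b ha hb => rw [map_add]; exact ha.add_right hb

/-- The free algebra in the variables `A` and `B`. -/
abbrev FreeTwo (k : Type*) [CommRing k] := FreeAlgebra k (Fin 2)

namespace IsAssociator

variable {k R : Type*} [Field k] [Ring R] [Algebra k R] {c : k} {Φ : NCSeries k}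

theorem eval_swap_mul (hΦ : IsAssociator c Φ) (x y : R) : Φ.eval y x * Φ.eval x y = 1 := by
  have h := congrArg (PowerSeries.map
    (FreeAlgebra.lift k (![x, y] : Fin 2 → R) : FreeAlgebra k (Fin 2) →+* R)) hΦ.inverse.1
  rw [map_mul, Φ.map_eval, Φ.map_eval, map_one] at h
  simpa [ncA, ncB] using h

/-- The pentagon is responsible: `exp(A - B)` is group-like and satisfies the inversion relation,
yet violates this. -/
theorem eval_zero_right (hΦ : IsAssociator c Φ) (x : R) : Φ.eval x 0 = 1 := by
  -- The pentagon is specialized by sending the generator of the first two strands to `x` and all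
  -- others to `0`. The case `x = 0`, with the inversion relation, gives `Φ(0, 0) = 1`; the general
  -- case then makes `Φ(x, 0)` idempotent, and it is invertible.
  have key : ∀ x : R, Φ.eval x 0 * Φ.eval 0 0 = Φ.eval 0 0 * Φ.eval x 0 * Φ.eval x 0 := by
    intro x
    let t : Fin 4 → Fin 4 → R := fun i j =>
      if (i = 0 ∧ j = 1) ∨ (i = 1 ∧ j = 0) then x else 0
    have ht : ∀ i j l m, Commute (t i j) (t l m) := by
      intro i j l m
      dsimp only [t]
      split_ifs
      exacts [Commute.refl x, Commute.zero_right x, Commute.zero_left x, Commute.zero_left 0]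
    obtain ⟨f, hf⟩ := PureInfBraid.exists_lift (k := k) t
      (fun i j => by dsimp only [t]; exact if_congr (by tauto) rfl rfl)
      (fun i => if_neg (by rintro (⟨h, h'⟩ | ⟨h, h'⟩) <;> simp [h] at h'))
      (fun i j l m _ _ _ _ _ _ => ht i j l m)
      (fun i j l => (ht _ _ _ _).add_right (ht _ _ _ _))
    have h := congrArg (PowerSeries.map (f : PureInfBraid k 4 →+* R)) hΦ.pentagon
    simp only [map_mul, Φ.map_eval, map_add, hf] at h
    simpa [t] using h
  have hz : Φ.eval (0 : R) 0 = 1 := by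
    have h₁ := key 0
    have h₂ := hΦ.eval_swap_mul (0 : R) 0
    rwa [h₂, one_mul, eq_comm] at h₁
  have h₁ := key x
  rw [hz, one_mul, mul_one] at h₁
  have h₂ := congrArg (Φ.eval 0 x * ·) h₁
  simpa [← mul_assoc, hΦ.eval_swap_mul] using h₂.symm

theorem eval_zero_left (hΦ : IsAssociator c Φ) (x : R) : Φ.eval 0 x = 1 := by
  simpa [hΦ.eval_zero_right] using hΦ.eval_swap_mul x 0

open scoped TensorProduct in
-- Two pairs that commute with each other define a homomorphism from the tensor square of the free
-- algebra; it carries group-likeness to this identity.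
theorem eval_add (hΦ : IsAssociator c Φ) {x y u v : R} (hxu : Commute x u) (hxv : Commute x v)
    (hyu : Commute y u) (hyv : Commute y v) :
    Φ.eval (x + u) (y + v) = Φ.eval x y * Φ.eval u v := by
  let f : FreeAlgebra k (Fin 2) ⊗[k] FreeAlgebra k (Fin 2) →ₐ[k] R :=
    Algebra.TensorProduct.lift (FreeAlgebra.lift k ![x, y]) (FreeAlgebra.lift k ![u, v])
      fun a b => FreeAlgebra.commute_lift (fun j => (FreeAlgebra.commute_lift
        (fun i => by fin_cases i <;> fin_cases j <;>
          first | exact hxu.symm | exact hxv.symm | exact hyu.symm | exact hyv.symm) a).symm) b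
  have h := congrArg (PowerSeries.map (f : _ →+* R)) hΦ.grouplike
  simp only [map_mul, Φ.map_eval, map_add] at h
  simpa [f, ncA, ncB] using h

/-- Split `(u, v)` as `(0, v) + (u, 0)`, up to order: each factor has a zero argument. -/
theorem eval_of_commute (hΦ : IsAssociator c Φ) {u v : R} (h : Commute u v) :
    Φ.eval u v = 1 := by
  simpa [hΦ.eval_zero_left, hΦ.eval_zero_right] using
    hΦ.eval_add (x := u) (y := 0) (u := 0) (v := v) (Commute.zero_right u) h
      (Commute.zero_left 0) (Commute.zero_left v)

theorem eval_add_central (hΦ : IsAssociator c Φ) {x y u v : R} (hxu : Commute x u)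
    (hxv : Commute x v) (hyu : Commute y u) (hyv : Commute y v) (huv : Commute u v) :
    Φ.eval (x + u) (y + v) = Φ.eval x y := by
  rw [hΦ.eval_add hxu hxv hyu hyv, hΦ.eval_of_commute huv, mul_one]

theorem hexagon_eval (hΦ : IsAssociator c Φ) {x y z : R} (h : x + y + z = 0) :
    hExp k (c • x) * Φ.eval z x * hExp k (c • z) * Φ.eval y z * hExp k (c • y) *
      Φ.eval x y = 1 := by
  have h' := congrArg (PowerSeries.map
    (FreeAlgebra.lift k (![x, y] : Fin 2 → R) : FreeAlgebra k (Fin 2) →+* R)) hΦ.hexagon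
  have hz : -x - y = z := by rw [← sub_eq_zero, ← neg_eq_zero, ← h]; abel
  simp only [map_mul, Φ.map_eval, map_hExp, map_one, map_smul] at h'
  simpa [ncA, ncB, ncC, hz] using h'

/-- The hexagonal relation for three elements with central sum. -/
theorem hexagon_central [CharZero k] (hΦ : IsAssociator c Φ) {x y z T : R} (h : x + y + z = T)
    (hx : Commute x T) (hy : Commute y T) :
    hExp k (c • x) * Φ.eval z x * hExp k (c • z) * Φ.eval y z * hExp k (c • y) *
      Φ.eval x y = hExp k (c • T) := by
  have hz : Commute z T := by
    have : z = T - x - y := by rw [← h]; abel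
    rw [this]
    exact ((Commute.refl T).sub_left hx).sub_left hy
  -- Subtracting `T` from `z` makes the sum zero. The values of `Φ` do not see this shift; only
  -- `exp(c z)` does, through the factor `exp(-c T)`, which is then moved to the right end.
  have h₀ := hΦ.hexagon_eval (x := x) (y := y) (z := z + -T) (by rw [← h]; abel)
  have h₁ : Φ.eval (z + -T) x = Φ.eval z x := by
    simpa using hΦ.eval_add_central (x := z) (y := x) (u := -T) (v := 0) hz.neg_right
      (Commute.zero_right _) hx.neg_right (Commute.zero_right _) (Commute.zero_right _)
  have h₂ : Φ.eval y (z + -T) = Φ.eval y z := by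
    simpa using hΦ.eval_add_central (x := y) (y := z) (u := 0) (v := -T)
      (Commute.zero_right _) hy.neg_right (Commute.zero_right _) hz.neg_right
      (Commute.zero_left _)
  have hzc : Commute (c • z) (c • T) := (hz.smul_left c).smul_right c
  have h₃ : hExp k (c • (z + -T)) = hExp k (c • z) * hExp k (-(c • T)) := by
    rw [smul_add, smul_neg, hExp_add hzc.neg_right]
  have hxT : Commute T (c • x) := hx.symm.smul_right c
  have hyT : Commute T (c • y) := hy.symm.smul_right c
  have c₁ : Commute (hExp k (-(c • T))) (Φ.eval y z) :=
    commute_hExp_eval Φ (hy.symm.smul_left c).neg_left (hz.symm.smul_left c).neg_left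
  have c₂ : Commute (hExp k (-(c • T))) (hExp k (c • y)) :=
    commute_hExp_hExp (hyT.smul_left c).neg_left
  have c₃ : Commute (hExp k (-(c • T))) (Φ.eval x y) :=
    commute_hExp_eval Φ (hx.symm.smul_left c).neg_left (hy.symm.smul_left c).neg_left
  rw [h₁, h₂, h₃] at h₀
  have h₄ : hExp k (c • x) * Φ.eval z x * hExp k (c • z) * Φ.eval y z * hExp k (c • y) *
      Φ.eval x y * hExp k (-(c • T)) = 1 := by
    rw [← h₀]
    simp only [mul_assoc]
    rw [← c₃.eq, ← mul_assoc (hExp k (c • y)), ← c₂.eq, mul_assoc, ← mul_assoc (Φ.eval y z),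
      ← c₁.eq, mul_assoc]
  have h₅ := congrArg (· * hExp k (c • T)) h₄
  simpa [mul_assoc, hExp_neg_mul_self] using h₅

open MulOpposite in
open scoped TensorProduct in
/-- The antipode inverts `Φ`. -/
theorem antipode (hΦ : IsAssociator c Φ) (x y : R) :
    (PowerSeries.mk fun d => unop (PowerSeries.coeff d (Φ.eval (op (-x)) (op (-y))))) *
      Φ.eval x y = 1 := by
  let S : FreeTwo k →ₐ[k] Rᵐᵒᵖ := FreeAlgebra.lift k ![op (-x), op (-y)]
  let g : FreeTwo k →ₐ[k] R := FreeAlgebra.lift k ![x, y]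
  -- The convolution `m ∘ (S ⊗ id)`, evaluated in `R`; it is linear but not multiplicative.
  let μ : FreeTwo k ⊗[k] FreeTwo k →ₗ[k] R :=
    LinearMap.mul' k R ∘ₗ TensorProduct.map ((opLinearEquiv k).symm.toLinearMap ∘ₗ S.toLinearMap)
      g.toLinearMap
  have hμ : ∀ a b, μ (a ⊗ₜ b) = unop (S a) * g b := fun a b => rfl
  -- For a letter `X`, reversal of products gives `S(X a) = -S(a) X`, which cancels against the term
  -- `S(a) (X b)`. Hence `μ` kills every word of positive length in the coproducts of the letters,
  -- and only the constant term survives.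
  have hprim : ∀ (i : Fin 2) (z : FreeTwo k ⊗[k] FreeTwo k),
      μ ((FreeAlgebra.ι k i ⊗ₜ[k] 1 + 1 ⊗ₜ[k] FreeAlgebra.ι k i) * z) = 0 := by
    intro i z
    have hi : unop (S (FreeAlgebra.ι k i)) = - g (FreeAlgebra.ι k i) := by
      fin_cases i <;> simp [S, g]
    induction z using TensorProduct.induction_on with
    | zero => simp
    | tmul a b =>
      rw [add_mul, Algebra.TensorProduct.tmul_mul_tmul, Algebra.TensorProduct.tmul_mul_tmul,
        map_add, hμ, hμ, map_mul, map_mul, unop_mul, hi]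
      simp [mul_assoc]
    | add a b ha hb => rw [mul_add, map_add, ha, hb, add_zero]
  have hcoeff : ∀ d, μ (PowerSeries.coeff d (Φ.eval
      (ncA k ⊗ₜ[k] 1 + 1 ⊗ₜ[k] ncA k : FreeTwo k ⊗[k] FreeTwo k) (ncB k ⊗ₜ[k] 1 + 1 ⊗ₜ[k] ncB k))) =
      PowerSeries.coeff d (1 : R⟦X⟧) := by
    rintro (_ | d)
    · have h₀ : PowerSeries.coeff 0 (Φ.eval
          (ncA k ⊗ₜ[k] 1 + 1 ⊗ₜ[k] ncA k : FreeTwo k ⊗[k] FreeTwo k)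
          (ncB k ⊗ₜ[k] 1 + 1 ⊗ₜ[k] ncB k)) = 1 := by
        have h := congrArg (PowerSeries.coeff 0) (hΦ.eval_zero_left (0 : FreeTwo k ⊗[k] FreeTwo k))
        rw [Φ.coeff_eval] at h ⊢
        simpa using h
      rw [h₀, Algebra.TensorProduct.one_def, hμ]
      simp
    · rw [Φ.coeff_eval, map_sum, PowerSeries.coeff_one, if_neg (Nat.succ_ne_zero d)]
      refine Finset.sum_eq_zero fun w _ => ?_
      rw [map_smul, List.ofFn_succ (f := fun i => (![_, _] : Fin 2 → _) (w i)),
        List.prod_cons]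
      have hw : (![ncA k ⊗ₜ[k] 1 + 1 ⊗ₜ[k] ncA k, ncB k ⊗ₜ[k] 1 + 1 ⊗ₜ[k] ncB k] :
          Fin 2 → FreeTwo k ⊗[k] FreeTwo k) (w 0) =
          FreeAlgebra.ι k (w 0) ⊗ₜ[k] 1 + 1 ⊗ₜ[k] FreeAlgebra.ι k (w 0) := by
        generalize w 0 = i
        fin_cases i <;> rfl
      rw [hw, hprim, smul_zero]
  ext d
  rw [← hcoeff d, hΦ.grouplike, PowerSeries.coeff_mul, PowerSeries.coeff_mul, map_sum]
  refine Finset.sum_congr rfl fun p _ => ?_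
  have hl : PowerSeries.coeff p.1
      (Φ.eval (ncA k ⊗ₜ[k] 1 : FreeTwo k ⊗[k] FreeTwo k) (ncB k ⊗ₜ[k] 1)) =
      PowerSeries.coeff p.1 (Φ.eval (ncA k) (ncB k)) ⊗ₜ[k] 1 :=
    Φ.coeff_eval_map
      (Algebra.TensorProduct.includeLeft : FreeTwo k →ₐ[k] FreeTwo k ⊗[k] FreeTwo k) _ _ _
  have hr : PowerSeries.coeff p.2
      (Φ.eval (1 ⊗ₜ[k] ncA k : FreeTwo k ⊗[k] FreeTwo k) (1 ⊗ₜ[k] ncB k)) =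
      1 ⊗ₜ[k] PowerSeries.coeff p.2 (Φ.eval (ncA k) (ncB k)) :=
    Φ.coeff_eval_map
      (Algebra.TensorProduct.includeRight : FreeTwo k →ₐ[k] FreeTwo k ⊗[k] FreeTwo k) _ _ _
  rw [hl, hr, Algebra.TensorProduct.tmul_mul_tmul, mul_one, one_mul, hμ, ← Φ.coeff_eval_map S,
    ← Φ.coeff_eval_map g, PowerSeries.coeff_mk]
  simp [S, g, ncA, ncB]

end IsAssociator

/-! ### Relations between infinitesimal braids -/

namespace InfBraid

variable {k : Type*} [CommRing k] {n : ℕ}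

theorem perm_one : perm k (1 : Equiv.Perm (Fin n)) = 1 := by
  rw [perm, RingQuot.mkAlgHom_rel k (InfBraidRel.perm_one (k := k)), map_one]

theorem perm_mul (s s' : Equiv.Perm (Fin n)) : perm k (s * s') = perm k s * perm k s' := by
  rw [perm, RingQuot.mkAlgHom_rel k (InfBraidRel.perm_mul s s'), map_mul]
  rfl

theorem semiconjBy_perm_t (s : Equiv.Perm (Fin n)) (i j : Fin n) :
    SemiconjBy (perm k s) (t k i j) (t k (s i) (s j)) := by
  have h := RingQuot.mkAlgHom_rel k (InfBraidRel.act (k := k) s i j)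
  rwa [map_mul, map_mul] at h

theorem mk_lift_eq {a b : FreeAlgebra k (Fin n × Fin n)} (h : PureInfBraidRel k n a b) :
    FreeAlgebra.lift k (fun p : Fin n × Fin n => t k p.1 p.2) a =
      FreeAlgebra.lift k (fun p : Fin n × Fin n => t k p.1 p.2) b := by
  have hcomp : FreeAlgebra.lift k (fun p : Fin n × Fin n => t k p.1 p.2) =
      (RingQuot.mkAlgHom k (InfBraidRel k n)).comp
        (FreeAlgebra.lift k fun p => FreeAlgebra.ι k (Sum.inr p)) := by
    ext p
    simp [t]
  rw [hcomp]
  exact RingQuot.mkAlgHom_rel k (InfBraidRel.pure a b h)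

theorem t_symm (i j : Fin n) : t k i j = t k j i := by
  simpa using mk_lift_eq (k := k) (PureInfBraidRel.symm i j)

theorem t_self (i : Fin n) : t k i i = 0 := by
  simpa using mk_lift_eq (k := k) (PureInfBraidRel.diag i)

theorem t_comm {i j l m : Fin n} (hij : i ≠ j) (hil : i ≠ l) (him : i ≠ m) (hjl : j ≠ l)
    (hjm : j ≠ m) (hlm : l ≠ m) : Commute (t k i j) (t k l m) := by
  simpa [Commute, SemiconjBy] using
    mk_lift_eq (k := k) (PureInfBraidRel.comm i j l m hij hil him hjl hjm hlm)

theorem t_four (i j l : Fin n) : Commute (t k i j) (t k i l + t k l j) := by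
  simpa [Commute, SemiconjBy] using mk_lift_eq (k := k) (PureInfBraidRel.four i j l)

/-- The relations between the sums of the generators over disjoint groups of strands. -/
theorem commute_sum_four {I J L : Finset (Fin n)} (hIJ : Disjoint I J) (hIL : Disjoint I L)
    (hJL : Disjoint J L) :
    Commute (∑ i ∈ I, ∑ j ∈ J, t k i j)
      (∑ i ∈ I, ∑ l ∈ L, t k i l + ∑ l ∈ L, ∑ j ∈ J, t k l j) := by
  refine Commute.sum_left _ _ _ fun i hi => Commute.sum_left _ _ _ fun j hj => ?_
  rw [Finset.sum_comm, ← Finset.sum_add_distrib]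
  refine Commute.sum_right _ _ _ fun l hl => ?_
  have hij : i ≠ j := fun h => Finset.disjoint_left.mp hIJ hi (h ▸ hj)
  have hil : i ≠ l := fun h => Finset.disjoint_left.mp hIL hi (h ▸ hl)
  have hjl : j ≠ l := fun h => Finset.disjoint_left.mp hJL hj (h ▸ hl)
  -- For a fixed `l`, the terms `t_{il}` and `t_{lj}` together commute with `t_{ij}` by the
  -- four-term relation; all remaining terms share no strand with it.
  rw [← Finset.add_sum_erase I _ hi, ← Finset.add_sum_erase J _ hj, add_add_add_comm]
  refine (t_four i j l).add_right (Commute.add_right ?_ ?_)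
  · refine Commute.sum_right _ _ _ fun i' hi' => ?_
    have hi'I := Finset.mem_of_mem_erase hi'
    exact t_comm hij (Finset.ne_of_mem_erase hi').symm hil
      (fun h => Finset.disjoint_left.mp hIJ hi'I (h ▸ hj)) hjl
      (fun h => Finset.disjoint_left.mp hIL hi'I (h ▸ hl))
  · refine Commute.sum_right _ _ _ fun j' hj' => ?_
    have hj'J := Finset.mem_of_mem_erase hj'
    exact t_comm hij hil (fun h => Finset.disjoint_left.mp hIJ hi (h ▸ hj'J)) hjl
      (Finset.ne_of_mem_erase hj').symm
      (fun h => Finset.disjoint_left.mp hJL hj'J (h ▸ hl))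

/-- The homomorphism `U 𝒯_m → 𝔅_n` that replaces each strand by a group of strands. -/
theorem exists_cabling {m : ℕ} (p : Fin m → Finset (Fin n))
    (hp : ∀ I J, I ≠ J → Disjoint (p I) (p J)) :
    ∃ f : PureInfBraid k m →ₐ[k] InfBraid k n, ∀ I J, I ≠ J →
      f (PureInfBraid.t k I J) = ∑ i ∈ p I, ∑ j ∈ p J, t k i j := by
  -- The diagonal has to be set to `0` by hand: the double sum over a single group of strands need
  -- not vanish.
  let T : Fin m → Fin m → InfBraid k n :=
    fun I J => if I = J then 0 else ∑ i ∈ p I, ∑ j ∈ p J, t k i j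
  have hT : ∀ {I J}, I ≠ J → T I J = ∑ i ∈ p I, ∑ j ∈ p J, t k i j := fun h => if_neg h
  have hT₀ : ∀ I, T I I = 0 := fun I => if_pos rfl
  suffices h : ∃ f : PureInfBraid k m →ₐ[k] InfBraid k n, ∀ I J, f (PureInfBraid.t k I J) = T I J
    from h.imp fun f hf I J h => (hf I J).trans (hT h)
  refine PureInfBraid.exists_lift T ?_ hT₀ ?_ ?_
  · intro I J
    by_cases h : I = J
    · rw [h]
    · rw [hT h, hT (Ne.symm h), Finset.sum_comm]
      exact Finset.sum_congr rfl fun j _ => Finset.sum_congr rfl fun i _ => t_symm i j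
  · intro I J L M hIJ hIL hIM hJL hJM hLM
    rw [hT hIJ, hT hLM]
    refine Commute.sum_left _ _ _ fun i hi => Commute.sum_left _ _ _ fun j hj =>
      Commute.sum_right _ _ _ fun l hl => Commute.sum_right _ _ _ fun m hm => ?_
    have hne : ∀ {I J}, I ≠ J → ∀ {a b}, a ∈ p I → b ∈ p J → a ≠ b :=
      fun h _ _ ha hb hab => Finset.disjoint_left.mp (hp _ _ h) ha (hab ▸ hb)
    exact t_comm (hne hIJ hi hj) (hne hIL hi hl) (hne hIM hi hm) (hne hJL hj hl) (hne hJM hj hm)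
      (hne hLM hl hm)
  · intro I J L
    by_cases hIJ : I = J
    · rw [hIJ, hT₀]; exact Commute.zero_left _
    by_cases hIL : I = L
    · rw [← hIL, hT₀, zero_add]
      exact Commute.refl _
    by_cases hJL : J = L
    · rw [← hJL, hT₀, add_zero]
      exact Commute.refl _
    rw [hT hIJ, hT hIL, hT (Ne.symm hJL)]
    exact commute_sum_four (hp _ _ hIJ) (hp _ _ hIL) (hp _ _ hJL)

theorem semiconjBy_perm_Y (s : Equiv.Perm (Fin n)) (r : Fin n)
    (h : ∀ j, s j < s r ↔ j < r) : SemiconjBy (perm k s) (Y k r) (Y k (s r)) := by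
  have hY : Y k (s r) = ∑ j ∈ Finset.univ.filter (fun j => j < r), t k (s j) (s r) := by
    rw [Y]
    refine (Finset.sum_equiv s (fun j => ?_) fun j _ => rfl).symm
    simp [h]
  rw [hY, Y, SemiconjBy, Finset.mul_sum, Finset.sum_mul]
  exact Finset.sum_congr rfl fun j _ => semiconjBy_perm_t s j r

/-- `Y_r` contains both `t_{ir}` and `t_{jr}`, whose sum is handled by the four-term relation; the
other terms are disjoint from `i` and `j`. -/
theorem commute_t_Y {i j r : Fin n} (hi : i < r) (hj : j < r) : Commute (t k i j) (Y k r) := by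
  by_cases hij : i = j
  · rw [hij, t_self]; exact Commute.zero_left _
  rw [Y, ← Finset.add_sum_erase _ _ (show i ∈ Finset.univ.filter (· < r) by simpa),
    ← Finset.add_sum_erase _ _ (show j ∈ (Finset.univ.filter (· < r)).erase i by
      simpa using ⟨Ne.symm hij, hj⟩), ← add_assoc, t_symm j r]
  refine (t_four i j r).add_right (Commute.sum_right _ _ _ fun l hl => ?_)
  simp only [Finset.mem_erase, Finset.mem_filter, Finset.mem_univ, true_and] at hl
  exact t_comm hij (Ne.symm hl.2.1) hi.ne (Ne.symm hl.1) hj.ne hl.2.2.ne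

theorem commute_Y_Y {q r : Fin n} (h : q < r) : Commute (Y k q) (Y k r) := by
  rw [Y]
  refine Commute.sum_left _ _ _ fun j hj => commute_t_Y (lt_trans ?_ h) h
  simpa using hj

theorem commute_perm_Y {a b r : Fin n} (ha : a < r) (hb : b < r) :
    Commute (perm k (Equiv.swap a b)) (Y k r) := by
  have hr : Equiv.swap a b r = r := Equiv.swap_apply_of_ne_of_ne ha.ne' hb.ne'
  have h := semiconjBy_perm_Y (k := k) (Equiv.swap a b) r fun j => by
    rw [hr, Equiv.swap_apply_def]
    split_ifs <;> simp_all
  rwa [hr] at h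

theorem commute_perm_swap_t (a b : Fin n) : Commute (perm k (Equiv.swap a b)) (t k a b) := by
  have h := semiconjBy_perm_t (k := k) (Equiv.swap a b) a b
  rwa [Equiv.swap_apply_left, Equiv.swap_apply_right, t_symm b a] at h

theorem commute_perm_t_of_disjoint {a b i j : Fin n} (h₁ : a ≠ i) (h₂ : a ≠ j) (h₃ : b ≠ i)
    (h₄ : b ≠ j) : Commute (perm k (Equiv.swap a b)) (t k i j) := by
  have h := semiconjBy_perm_t (k := k) (Equiv.swap a b) i j
  rwa [Equiv.swap_apply_of_ne_of_ne h₁.symm h₃.symm,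
    Equiv.swap_apply_of_ne_of_ne h₂.symm h₄.symm] at h

theorem commute_perm_Y_of_lt {a b r : Fin n} (ha : r < a) (hb : r < b) :
    Commute (perm k (Equiv.swap a b)) (Y k r) := by
  rw [Y]
  refine Commute.sum_right _ _ _ fun l hl => ?_
  have hl : l < r := by simpa using hl
  exact commute_perm_t_of_disjoint (hl.trans ha).ne' ha.ne' (hl.trans hb).ne' hb.ne'

theorem commute_t_Y_of_lt {i j r : Fin n} (hij : i ≠ j) (hi : r < i) (hj : r < j) :
    Commute (t k i j) (Y k r) := by
  rw [Y]
  refine Commute.sum_right _ _ _ fun l hl => ?_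
  have hl : l < r := by simpa using hl
  exact t_comm hij (hl.trans hi).ne' hi.ne' (hl.trans hj).ne' hj.ne' hl.ne

end InfBraid

/-! ### The braid relations -/

section CommuteC

variable {k R : Type*} [Ring R]

theorem PowerSeries.commute_C_iff {g : R⟦X⟧} {u : R} :
    Commute g (PowerSeries.C u) ↔ ∀ d, Commute (PowerSeries.coeff d g) u := by
  refine ⟨fun h d => ?_, fun h => (PowerSeries.semiconjBy_C fun d => (h d).symm).symm⟩
  simpa [Commute, SemiconjBy, PowerSeries.coeff_mul_C, PowerSeries.coeff_C_mul] using
    congrArg (PowerSeries.coeff d) h.eq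

variable [Field k] [Algebra k R]

theorem NCSeries.commute_eval_of_C (Φ : NCSeries k) {g : R⟦X⟧} {x y : R}
    (hx : Commute g (PowerSeries.C x)) (hy : Commute g (PowerSeries.C y)) :
    Commute g (Φ.eval x y) :=
  PowerSeries.commute_of_coeff fun i =>
    Φ.commute_coeff_eval (PowerSeries.commute_C_iff.mp hx i) (PowerSeries.commute_C_iff.mp hy i)

theorem commute_hExp_of_C {g : R⟦X⟧} {x : R} (hx : Commute g (PowerSeries.C x)) (c : k) :
    Commute g (hExp k (c • x)) :=
  PowerSeries.commute_of_coeff fun i =>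
    semiconjBy_coeff_hExp ((PowerSeries.commute_C_iff.mp hx i).smul_right c)

theorem PowerSeries.commute_C_C {x y : R} (h : Commute x y) :
    Commute (PowerSeries.C x) (PowerSeries.C y) :=
  h.map PowerSeries.C

end CommuteC

/-! ### Commutation of distant generators -/

section Far

variable {k : Type*} [Field k] {n : ℕ}

/-- Since `g` is an arbitrary series, this can be applied twice: with `g` a whole Drinfeld element,
then with `g` a constant. -/
theorem commute_drinfeldElement_of_C (c : k) (Φ : NCSeries k) {i : Fin (n - 1)}
    {g : (InfBraid k n)⟦X⟧}
    (ht : Commute g (PowerSeries.C (InfBraid.t k (strandLeft i) (strandRight i))))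
    (hY : Commute g (PowerSeries.C (InfBraid.Y k (strandLeft i))))
    (hs : Commute g
      (PowerSeries.C (InfBraid.perm k (Equiv.swap (strandLeft i) (strandRight i))))) :
    Commute g (drinfeldElement c Φ i) :=
  (((Φ.commute_eval_of_C ht hY).mul_right hs).mul_right (commute_hExp_of_C ht c)).mul_right
    (Φ.commute_eval_of_C hY ht)

theorem drinfeldElement_commute (c : k) (Φ : NCSeries k) {i j : Fin (n - 1)}
    (hij : (i : ℕ) + 2 ≤ j) : Commute (drinfeldElement c Φ i) (drinfeldElement c Φ j) := by
  have h₁ : strandLeft i < strandLeft j := by simp only [strandLeft, Fin.mk_lt_mk]; omega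
  have h₂ : strandRight i < strandLeft j := by
    simp only [strandLeft, strandRight, Fin.mk_lt_mk]; omega
  have h₃ : strandLeft i < strandRight i := by
    simp only [strandLeft, strandRight, Fin.mk_lt_mk]; omega
  have h₄ : strandLeft j < strandRight j := by
    simp only [strandLeft, strandRight, Fin.mk_lt_mk]; omega
  have h₅ := h₁.trans h₄
  have h₆ := h₂.trans h₄
  have hss : Commute (InfBraid.perm k (Equiv.swap (strandLeft j) (strandRight j)))
      (InfBraid.perm k (Equiv.swap (strandLeft i) (strandRight i))) := by
    rw [Commute, SemiconjBy, ← InfBraid.perm_mul, ← InfBraid.perm_mul]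
    congr 1
    refine (Equiv.Perm.Disjoint.commute fun x => ?_).eq
    by_cases hx : x = strandLeft j ∨ x = strandRight j
    · right
      rcases hx with rfl | rfl
      · exact Equiv.swap_apply_of_ne_of_ne h₁.ne' h₂.ne'
      · exact Equiv.swap_apply_of_ne_of_ne h₅.ne' h₆.ne'
    · left
      push Not at hx
      exact Equiv.swap_apply_of_ne_of_ne hx.1 hx.2
  -- What remains are the nine commutations between `t`, `Y`, `s` of one generator and `t`, `Y`, `s`
  -- of the other.
  refine commute_drinfeldElement_of_C c Φ ?_ ?_ ?_ <;> refine Commute.symm ?_ <;>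
    refine commute_drinfeldElement_of_C c Φ ?_ ?_ ?_ <;> refine PowerSeries.commute_C_C ?_
  · exact InfBraid.t_comm h₄.ne h₁.ne' h₂.ne' h₅.ne' h₆.ne' h₃.ne
  · exact InfBraid.commute_t_Y_of_lt h₄.ne h₁ h₅
  · exact (InfBraid.commute_perm_t_of_disjoint h₁.ne h₅.ne h₂.ne h₆.ne).symm
  · exact (InfBraid.commute_t_Y h₁ h₂).symm
  · exact (InfBraid.commute_Y_Y h₁).symm
  · exact (InfBraid.commute_perm_Y h₁ h₂).symm
  · exact InfBraid.commute_perm_t_of_disjoint h₁.ne' h₂.ne' h₅.ne' h₆.ne'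
  · exact InfBraid.commute_perm_Y_of_lt h₁ h₅
  · exact hss

end Far

/-! ### The braid relation deduced from hexagon and pentagon -/

namespace IsAssociator

variable {k R : Type*} [Field k] [CharZero k] [Ring R] [Algebra k R] {c : k} {Φ : NCSeries k}

/-- The braid relation on three strands. -/
theorem braid_three (hΦ : IsAssociator c Φ) {x y z s s' : R}
    (hxT : Commute x (x + y + z)) (hyT : Commute y (x + y + z))
    (hx : SemiconjBy s x x) (hy : SemiconjBy s y z) (hz : SemiconjBy s z y)
    (hx' : SemiconjBy s' x z) (hy' : SemiconjBy s' y y) (hz' : SemiconjBy s' z x)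
    (hs : s * s' * s = s' * s * s') :
    PowerSeries.C s * hExp k (c • x) *
        (Φ.eval y x * (PowerSeries.C s' * hExp k (c • y)) * Φ.eval x y) *
        (PowerSeries.C s * hExp k (c • x)) =
      Φ.eval y x * (PowerSeries.C s' * hExp k (c • y)) * Φ.eval x y *
        (PowerSeries.C s * hExp k (c • x)) *
        (Φ.eval y x * (PowerSeries.C s' * hExp k (c • y)) * Φ.eval x y) := by
  have smul : ∀ {u v w : R}, SemiconjBy u v w → SemiconjBy u (c • v) (c • w) := by
    intro u v w h
    rw [SemiconjBy, mul_smul_comm, smul_mul_assoc, h.eq]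
  have hS : PowerSeries.C s * (PowerSeries.C s' * PowerSeries.C s) =
      PowerSeries.C s' * (PowerSeries.C s * PowerSeries.C s') := by
    rw [← map_mul, ← map_mul, ← map_mul, ← map_mul, ← mul_assoc, hs, mul_assoc]
  -- The order `y, x, z` is dictated by the left side: once the permutations are moved to the left,
  -- what is left over is this hexagon without its last factor `Φ(y, x)`.
  have hexa := hΦ.hexagon_central (x := y) (y := x) (z := z) (T := x + y + z) (by abel) hyT hxT
  have hsT' : SemiconjBy s' (x + y + z) (x + y + z) := by
    have := (hx'.add_right hy').add_right hz'
    rwa [show z + y + x = x + y + z by abel] at this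
  have hTy : Commute (hExp k (c • (x + y + z))) (hExp k (c • y)) :=
    commute_hExp_hExp ((hyT.symm.smul_left c).smul_right c)
  have hFF := hΦ.eval_swap_mul x y
  have hE := hExp_neg_mul_self (k := k) (c • y)
  have push : ∀ {u v w : R⟦X⟧}, SemiconjBy u v w → ∀ q, w * (u * q) = u * (v * q) := by
    intro u v w h q
    rw [← mul_assoc, ← h.eq, mul_assoc]
  have b₁ := push (semiconjBy_C_hExp (k := k) (smul hz'))
  have b₂ := push (Φ.semiconjBy_C_eval hy' hz')
  have b₃ := push (semiconjBy_C_hExp (k := k) (smul hsT'))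
  have b₄ := push (semiconjBy_C_hExp (k := k) (smul hy').neg_right)
  have a₁ := push (semiconjBy_C_hExp (k := k) (smul hy))
  have a₂ := push (semiconjBy_C_hExp (k := k) (smul hz))
  have a₃ := push (Φ.semiconjBy_C_eval hx hz)
  have a₄ := push (Φ.semiconjBy_C_eval hz hy)
  generalize hExp k (c • (x + y + z)) = eT at *
  generalize hExp k (-(c • y)) = ny at *
  generalize hExp k (c • x) = ex at *
  generalize hExp k (c • y) = ey at *
  generalize hExp k (c • z) = ez at *
  generalize PowerSeries.C s = a at *
  generalize PowerSeries.C s' = b at *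
  generalize Φ.eval x y = Fxy at *
  generalize Φ.eval y x = Fyx at *
  generalize Φ.eval x z = Fxz at *
  generalize Φ.eval y z = Fyz at *
  generalize Φ.eval z y = Fzy at *
  have h₁ : ey * (Fzy * (ez * (Fxz * ex))) = eT * Fxy := by
    rw [← hexa, mul_assoc _ Fyx, hFF]
    simp only [mul_assoc, mul_one]
  -- The same hexagon, now without its first factor `exp(c y)`: this is the form that occurs on the
  -- right side of the braid relation.
  have h₂ : ∀ q, Fzy * (ez * (Fxz * (ex * (Fyx * q)))) = ny * (eT * q) := by
    intro q
    rw [← hexa]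
    simp only [mul_assoc]
    rw [← mul_assoc ny, hE, one_mul]
  calc _ = a * (b * (a * (ey * (Fzy * (ez * (Fxz * ex)))))) := by
        simp only [mul_assoc]
        rw [b₂, b₁, a₃, a₂, a₄, a₁]
    _ = a * (b * a) * (eT * Fxy) := by rw [h₁]; simp only [mul_assoc]
    _ = b * (a * (b * (ny * (ey * (eT * Fxy))))) := by
        rw [hS, ← mul_assoc ny, hE, one_mul]
        simp only [mul_assoc]
    _ = b * (a * (b * (ny * (eT * (ey * Fxy))))) := by
        rw [← mul_assoc ey, ← hTy.eq, mul_assoc]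
    _ = b * (a * (Fzy * (ez * (Fxz * (ex * (Fyx * (b * (ey * Fxy)))))))) := by
        rw [h₂, b₃, b₄]
    _ = _ := by
        simp only [mul_assoc]
        conv_rhs => rw [b₂, a₃, a₂, a₄]

/-- The braid relation on four strands, the last three of which are braided. -/
theorem braid_four (hΦ : IsAssociator c Φ) {p q x y z s s' : R}
    (hpent : Φ.eval p (x + z) * Φ.eval (q + x) y =
      Φ.eval x y * Φ.eval (p + q) (z + y) * Φ.eval p x)
    (hxT : Commute x (x + y + z)) (hyT : Commute y (x + y + z))
    (hx : SemiconjBy s x x) (hy : SemiconjBy s y z) (hz : SemiconjBy s z y)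
    (hx' : SemiconjBy s' x z) (hy' : SemiconjBy s' y y) (hz' : SemiconjBy s' z x)
    (hp : SemiconjBy s p q) (hq : SemiconjBy s q p) (hp' : Commute s' p)
    (hpy : Commute p y) (hxpq : Commute x (p + q))
    (hs : s * s' * s = s' * s * s') :
    Φ.eval x p * PowerSeries.C s * hExp k (c • x) * Φ.eval p x *
        (Φ.eval y (q + x) * PowerSeries.C s' * hExp k (c • y) * Φ.eval (q + x) y) *
        (Φ.eval x p * PowerSeries.C s * hExp k (c • x) * Φ.eval p x) =
      Φ.eval y (q + x) * PowerSeries.C s' * hExp k (c • y) * Φ.eval (q + x) y *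
        (Φ.eval x p * PowerSeries.C s * hExp k (c • x) * Φ.eval p x) *
        (Φ.eval y (q + x) * PowerSeries.C s' * hExp k (c • y) * Φ.eval (q + x) y) := by
  have h₃ := hΦ.braid_three hxT hyT hx hy hz hx' hy' hz' hs
  have hxzy : Commute x (z + y) := by
    have := hxT.sub_right (Commute.refl x)
    rwa [show x + y + z - x = z + y by abel] at this
  have hyxz : Commute y (x + z) := by
    have := hyT.sub_right (Commute.refl y)
    rwa [show x + y + z - y = x + z by abel] at this
  have hspq : SemiconjBy s (p + q) (p + q) := by simpa [add_comm q p] using hp.add_right hq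
  have hszy : SemiconjBy s (z + y) (z + y) := by simpa [add_comm y z] using hz.add_right hy
  have hsxz : SemiconjBy s' (x + z) (x + z) := by simpa [add_comm z x] using hx'.add_right hz'
  -- The two symmetries that make the pentagon useful: `s` exchanges `p, q` and `y, z`, while `s'`
  -- fixes `p` and exchanges `x, z`.
  have c₁ : Commute (PowerSeries.C s * hExp k (c • x)) (Φ.eval (p + q) (z + y)) :=
    Commute.mul_left (Φ.semiconjBy_C_eval hspq hszy)
      (commute_hExp_eval Φ (hxpq.smul_left c) (hxzy.smul_left c))
  have c₂ : Commute (PowerSeries.C s' * hExp k (c • y)) (Φ.eval p (x + z)) :=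
    Commute.mul_left (Φ.semiconjBy_C_eval hp' hsxz)
      (commute_hExp_eval Φ (hpy.symm.smul_left c) (hyxz.smul_left c))
  have i₁ := hΦ.eval_swap_mul p x
  have i₁' := hΦ.eval_swap_mul x p
  have i₂ := hΦ.eval_swap_mul (p + q) (z + y)
  have i₂' := hΦ.eval_swap_mul (z + y) (p + q)
  have i₄' := hΦ.eval_swap_mul (x + z) p
  have i₃ := hΦ.eval_swap_mul (q + x) y
  have i₄ := hΦ.eval_swap_mul p (x + z)
  have i₅ := hΦ.eval_swap_mul y x
  simp only [mul_assoc _ (PowerSeries.C s), mul_assoc _ (PowerSeries.C s')] at h₃ ⊢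
  generalize PowerSeries.C s * hExp k (c • x) = a at *
  generalize PowerSeries.C s' * hExp k (c • y) = b at *
  generalize Φ.eval x p = Fxp at *
  generalize Φ.eval p x = Fpx at *
  generalize Φ.eval x y = Fxy at *
  generalize Φ.eval y x = Fyx at *
  generalize Φ.eval (q + x) y = G at *
  generalize Φ.eval y (q + x) = G' at *
  generalize Φ.eval (p + q) (z + y) = H at *
  generalize Φ.eval (z + y) (p + q) = H' at *
  generalize Φ.eval p (x + z) = J at *
  generalize Φ.eval (x + z) p = J' at *
  have cancel : ∀ {u v : R⟦X⟧}, u * v = 1 → ∀ w, u * (v * w) = w := by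
    intro u v h w
    rw [← mul_assoc, h, one_mul]
  have hG : G = J' * (Fxy * (H * Fpx)) := by
    rw [← cancel i₄ G, hpent]
    simp only [mul_assoc]
  have hG' : G' = Fxp * (H' * (Fyx * J)) := by
    have h : G * (Fxp * (H' * (Fyx * J))) = 1 := by
      rw [hG]
      simp only [mul_assoc]
      rw [cancel i₁', cancel i₂', cancel i₅, i₄]
    rw [← mul_one G', ← h, cancel i₃]
  -- `H * Fpx` is the common conjugator. `H` can be inserted around `a` because they commute; in
  -- `h₂` the pentagon produces `H * Fpx` together with `J`, which commutes with `b` and cancels.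
  have h₁ : Fxp * a * Fpx = Fxp * H' * a * (H * Fpx) := by
    simp only [mul_assoc]
    rw [← mul_assoc a, c₁.eq, mul_assoc, cancel i₂]
  have h₂ : G' * b * G = Fxp * H' * (Fyx * b * Fxy) * (H * Fpx) := by
    rw [hG, hG']
    simp only [mul_assoc]
    rw [← mul_assoc J, ← c₂.eq, mul_assoc, cancel i₄']
  have hQP : H * Fpx * (Fxp * H') = 1 := by
    rw [mul_assoc, cancel i₁', i₂']
  have conj : ∀ u v, Fxp * H' * u * (H * Fpx) * (Fxp * H' * v * (H * Fpx)) =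
      Fxp * H' * (u * v) * (H * Fpx) := by
    intro u v
    rw [mul_assoc _ (H * Fpx), ← mul_assoc (H * Fpx), ← mul_assoc (H * Fpx), hQP, one_mul]
    simp only [mul_assoc]
  rw [h₁, h₂, conj, conj, conj, conj, h₃]

end IsAssociator

/-! ### The braid relation for adjacent generators of `𝔅_n` -/

section Braid

variable {k : Type*} [Field k] [CharZero k] {n : ℕ} {c : k} {Φ : NCSeries k}

theorem drinfeldElement_braid (hΦ : IsAssociator c Φ) {i j : Fin (n - 1)}
    (hij : (i : ℕ) + 1 = j) :
    drinfeldElement c Φ i * drinfeldElement c Φ j * drinfeldElement c Φ i =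
      drinfeldElement c Φ j * drinfeldElement c Φ i * drinfeldElement c Φ j := by
  have hb : strandLeft j = strandRight i := by
    simp only [strandLeft, strandRight, Fin.mk.injEq]; omega
  simp only [drinfeldElement, hb]
  have hab : strandLeft i < strandRight i := by
    simp only [strandLeft, strandRight, Fin.mk_lt_mk]; omega
  have hbc : strandRight i < strandRight j := by
    simp only [strandRight, Fin.mk_lt_mk]; omega
  have hlt : ∀ l, l < strandRight i ↔ l < strandLeft i ∨ l = strandLeft i := by
    intro l
    simp only [strandLeft, strandRight, Fin.lt_def, Fin.ext_iff]; omega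
  generalize strandLeft i = a at *
  generalize strandRight i = b at *
  generalize strandRight j = d at *
  have had := hab.trans hbc
  let q : InfBraid k n := ∑ l ∈ Finset.univ.filter (fun l => l < a), InfBraid.t k l b
  have hYb : InfBraid.Y k b = q + InfBraid.t k a b := by
    have : Finset.univ.filter (fun l => l < b) =
        insert a (Finset.univ.filter (fun l => l < a)) := by
      ext l
      simp [hlt l, or_comm]
    rw [InfBraid.Y, this, Finset.sum_insert (by simp), add_comm]
  have hpent : Φ.eval (InfBraid.Y k a) (InfBraid.t k a b + InfBraid.t k a d) *
      Φ.eval (q + InfBraid.t k a b) (InfBraid.t k b d) =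
      Φ.eval (InfBraid.t k a b) (InfBraid.t k b d) *
        Φ.eval (InfBraid.Y k a + q) (InfBraid.t k a d + InfBraid.t k b d) *
        Φ.eval (InfBraid.Y k a) (InfBraid.t k a b) := by
    -- All strands before `a` form the first of four groups, followed by `a`, `b`, `d`. The first
    -- group may be empty, in which case `Y_a` and `q` are zero.
    obtain ⟨f, hf⟩ := InfBraid.exists_cabling (k := k)
      (![Finset.univ.filter (fun l => l < a), {a}, {b}, {d}] : Fin 4 → Finset (Fin n)) (by
        intro I J hIJ
        fin_cases I <;> fin_cases J <;>
          first
          | exact absurd rfl hIJ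
          | simp [hab.le, had.le, hab.ne, hbc.ne, had.ne, hab.ne', hbc.ne', had.ne'])
    have h := congrArg (PowerSeries.map (f : PureInfBraid k 4 →+* InfBraid k n)) hΦ.pentagon
    simp only [map_mul, Φ.map_eval, map_add] at h
    rw [hf 0 1 (by decide), hf 1 2 (by decide), hf 1 3 (by decide), hf 0 2 (by decide),
      hf 2 3 (by decide)] at h
    simpa [q, InfBraid.Y] using h
  have four : ∀ u v w : Fin n, Commute (InfBraid.t k u v)
      (InfBraid.t k u v + (InfBraid.t k u w + InfBraid.t k w v)) := fun u v w =>
    (Commute.refl _).add_right (InfBraid.t_four u v w)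
  have hxT : Commute (InfBraid.t k a b)
      (InfBraid.t k a b + InfBraid.t k b d + InfBraid.t k a d) := by
    have := four a b d
    rwa [InfBraid.t_symm d b, ← add_assoc, add_right_comm] at this
  have hyT : Commute (InfBraid.t k b d)
      (InfBraid.t k a b + InfBraid.t k b d + InfBraid.t k a d) := by
    have := four b d a
    rwa [InfBraid.t_symm b a, ← add_assoc, add_comm (InfBraid.t k b d)] at this
  have ab_t := InfBraid.semiconjBy_perm_t (k := k) (Equiv.swap a b)
  have bd_t := InfBraid.semiconjBy_perm_t (k := k) (Equiv.swap b d)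
  have fix_ab : ∀ l < a, Equiv.swap a b l = l := fun l hl =>
    Equiv.swap_apply_of_ne_of_ne hl.ne (hl.trans hab).ne
  have hs : InfBraid.perm k (Equiv.swap a b) * InfBraid.perm k (Equiv.swap b d) *
      InfBraid.perm k (Equiv.swap a b) = InfBraid.perm k (Equiv.swap b d) *
      InfBraid.perm k (Equiv.swap a b) * InfBraid.perm k (Equiv.swap b d) := by
    simp only [← InfBraid.perm_mul]
    -- Both products of three transpositions equal the transposition of `a` and `d`.
    rw [Equiv.swap_mul_swap_mul_swap hab.ne had.ne, Equiv.swap_comm a b, Equiv.swap_comm b d,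
      Equiv.swap_mul_swap_mul_swap hbc.ne' had.ne', Equiv.swap_comm]
  have ab_d : Equiv.swap a b d = d := Equiv.swap_apply_of_ne_of_ne had.ne' hbc.ne'
  have bd_a : Equiv.swap b d a = a := Equiv.swap_apply_of_ne_of_ne hab.ne had.ne
  rw [hYb]
  refine hΦ.braid_four (z := InfBraid.t k a d) hpent hxT hyT
    (InfBraid.commute_perm_swap_t a b) ?_ ?_ ?_ (InfBraid.commute_perm_swap_t b d) ?_ ?_ ?_
    (InfBraid.commute_perm_Y_of_lt hab had)
    (InfBraid.commute_t_Y_of_lt hbc.ne hab had).symm ?_ hs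
  · simpa [ab_d] using ab_t b d
  · simpa [ab_d] using ab_t a d
  · simpa [bd_a] using bd_t a b
  · simpa [bd_a] using bd_t a d
  · rw [InfBraid.Y, SemiconjBy, Finset.mul_sum, Finset.sum_mul]
    refine Finset.sum_congr rfl fun l hl => ?_
    simpa [fix_ab l (by simpa using hl)] using (ab_t l a).eq
  · rw [InfBraid.Y, SemiconjBy, Finset.mul_sum, Finset.sum_mul]
    refine Finset.sum_congr rfl fun l hl => ?_
    simpa [fix_ab l (by simpa using hl)] using (ab_t l b).eq
  · rw [InfBraid.Y, ← Finset.sum_add_distrib]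
    refine Commute.sum_right _ _ _ fun l _ => ?_
    simpa [InfBraid.t_symm l a] using InfBraid.t_four (k := k) a b l

end Braid

/-! ### Invertibility and matrices -/

section SeriesMatrix

variable {k : Type*} [Field k] {N : ℕ}

theorem seriesMatrix_mul (f g : (Matrix (Fin N) (Fin N) k)⟦X⟧) :
    seriesMatrix (f * g) = seriesMatrix f * seriesMatrix g := by
  ext a b d
  simp only [seriesMatrix, Matrix.of_apply, Matrix.mul_apply, PowerSeries.coeff_mk,
    PowerSeries.coeff_mul, map_sum, Matrix.sum_apply]
  exact Finset.sum_comm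

theorem seriesMatrix_C (G : Matrix (Fin N) (Fin N) k) :
    seriesMatrix (PowerSeries.C G) = G.map PowerSeries.C := by
  ext a b d
  simp only [seriesMatrix, Matrix.of_apply, PowerSeries.coeff_mk, PowerSeries.coeff_C,
    Matrix.map_apply]
  split_ifs <;> rfl

theorem seriesMatrix_one : seriesMatrix (1 : (Matrix (Fin N) (Fin N) k)⟦X⟧) = 1 := by
  rw [← map_one PowerSeries.C, seriesMatrix_C, Matrix.map_one _ (map_zero _) (map_one _)]

theorem IsUnit.seriesMatrix {f : (Matrix (Fin N) (Fin N) k)⟦X⟧} (hf : IsUnit f) :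
    IsUnit (seriesMatrix f) := by
  obtain ⟨g, hfg, hgf⟩ := isUnit_iff_exists.mp hf
  refine isUnit_iff_exists.mpr ⟨_root_.seriesMatrix g, ?_, ?_⟩
  · rw [← seriesMatrix_mul, hfg, seriesMatrix_one]
  · rw [← seriesMatrix_mul, hgf, seriesMatrix_one]

end SeriesMatrix

section Units

variable {k : Type*} [Field k] {n N : ℕ} {c : k} {Φ : NCSeries k}

theorem IsAssociator.isUnit_eval {R : Type*} [Ring R] [Algebra k R] (hΦ : IsAssociator c Φ)
    (x y : R) : IsUnit (Φ.eval x y) :=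
  ⟨⟨_, _, hΦ.eval_swap_mul y x, hΦ.eval_swap_mul x y⟩, rfl⟩

theorem isUnit_drinfeldElement [CharZero k] (hΦ : IsAssociator c Φ) (i : Fin (n - 1)) :
    IsUnit (drinfeldElement c Φ i) := by
  refine (((hΦ.isUnit_eval _ _).mul (IsUnit.map PowerSeries.C ?_)).mul ?_).mul
    (hΦ.isUnit_eval _ _)
  · have h : ∀ s : Equiv.Perm (Fin n), IsUnit (InfBraid.perm k s) := fun s =>
      isUnit_iff_exists.mpr ⟨InfBraid.perm k s⁻¹,
        by rw [← InfBraid.perm_mul, mul_inv_cancel, InfBraid.perm_one],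
        by rw [← InfBraid.perm_mul, inv_mul_cancel, InfBraid.perm_one]⟩
    exact h _
  · exact ⟨⟨_, _, hExp_mul_neg_self _, hExp_neg_mul_self _⟩, rfl⟩

theorem isUnit_drinfeldMatrix [CharZero k] (hΦ : IsAssociator c Φ)
    (ρ : InfBraid k n →ₐ[k] Matrix (Fin N) (Fin N) k) (i : Fin (n - 1)) :
    IsUnit (drinfeldMatrix c Φ ρ i) :=
  ((isUnit_drinfeldElement hΦ i).map (PowerSeries.map
    (ρ : InfBraid k n →+* Matrix (Fin N) (Fin N) k))).seriesMatrix

end Units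

/-! ### Existence and uniqueness of the lift -/

section Lift

variable {k : Type*} [Field k] {A : Subalgebra k k⟦X⟧}

/-- A non-unit of `A` is a multiple of `h`, hence a non-unit of `k⟦h⟧`. Applied to determinants,
this keeps the inverse matrices over `A`. -/
theorem IsDiscreteValuationSubring.isUnit_of_isUnit_coe (hA : IsDiscreteValuationSubring A)
    {f : A} (hf : IsUnit (f : k⟦X⟧)) : IsUnit f := by
  have := hA.isDVR
  by_contra h
  have hm : f ∈ IsLocalRing.maximalIdeal A := (IsLocalRing.mem_maximalIdeal f).mpr h
  rw [hA.irreducible_X.maximalIdeal_eq, Ideal.mem_span_singleton] at hm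
  have hd : PowerSeries.X ∣ (f : k⟦X⟧) := map_dvd A.val hm
  exact PowerSeries.X_prime.not_isUnit (isUnit_of_dvd_unit hd hf)

theorem Subalgebra.matrix_map_coe_injective {N : ℕ} :
    Function.Injective fun M : Matrix (Fin N) (Fin N) A => M.map (fun f : A => (f : k⟦X⟧)) :=
  Matrix.map_injective Subtype.val_injective

theorem Subalgebra.matrix_map_coe_mul {N : ℕ} (M M' : Matrix (Fin N) (Fin N) A) :
    (M * M').map (fun f : A => (f : k⟦X⟧)) =
      M.map (fun f : A => (f : k⟦X⟧)) * M'.map (fun f : A => (f : k⟦X⟧)) :=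
  Matrix.map_mul (f := (A.val : A →+* k⟦X⟧))

variable [CharZero k] {n N : ℕ} {c : k} {Φ : NCSeries k}

theorem existsUnique_drinfeldLift (hΦ : IsAssociator c Φ)
    (ρ : InfBraid k n →ₐ[k] Matrix (Fin N) (Fin N) k) (hA : IsDiscreteValuationSubring A)
    (hAρ : ∀ i a b, drinfeldMatrix c Φ ρ i a b ∈ A) :
    ∃! R : BraidGroup n →* Matrix.GeneralLinearGroup (Fin N) A, IsDrinfeldLift c Φ ρ R := by
  let M : Fin (n - 1) → Matrix (Fin N) (Fin N) A := fun i =>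
    Matrix.of fun a b => ⟨drinfeldMatrix c Φ ρ i a b, hAρ i a b⟩
  have hM : ∀ i, (M i).map (fun f : A => (f : k⟦X⟧)) = drinfeldMatrix c Φ ρ i := fun i => rfl
  have hunit : ∀ i, IsUnit (M i) := by
    intro i
    rw [Matrix.isUnit_iff_isUnit_det]
    refine hA.isUnit_of_isUnit_coe ?_
    have h := (Matrix.isUnit_iff_isUnit_det _).mp (isUnit_drinfeldMatrix hΦ ρ i)
    rw [← hM] at h
    have hdet : ((M i).det : k⟦X⟧) = ((M i).map (fun f : A => (f : k⟦X⟧))).det :=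
      RingHom.map_det (A.val : A →+* k⟦X⟧) (M i)
    rwa [hdet]
  let u : Fin (n - 1) → Matrix.GeneralLinearGroup (Fin N) A := fun i => (hunit i).unit
  have hu : ∀ i, (u i).1 = M i := fun i => rfl
  have hmul : ∀ i j, drinfeldMatrix c Φ ρ i * drinfeldMatrix c Φ ρ j =
      seriesMatrix (PowerSeries.map (ρ : InfBraid k n →+* Matrix (Fin N) (Fin N) k)
        (drinfeldElement c Φ i * drinfeldElement c Φ j)) := fun i j => by
    rw [map_mul, seriesMatrix_mul]
    rfl
  have hrel : ∀ r ∈ braidRelators n, FreeGroup.lift u r = 1 := by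
    rintro r (⟨i, j, hij, rfl⟩ | ⟨i, j, hij, rfl⟩)
    · simp only [map_mul, map_inv, FreeGroup.lift_apply_of]
      rw [mul_inv_eq_one]
      refine Units.ext (Subalgebra.matrix_map_coe_injective ?_)
      simp only [Units.val_mul, hu, Subalgebra.matrix_map_coe_mul, hM]
      rw [hmul, hmul]
      simp only [drinfeldMatrix]
      rw [← seriesMatrix_mul, ← seriesMatrix_mul, ← map_mul, ← map_mul,
        drinfeldElement_braid hΦ hij]
    · simp only [map_mul, map_inv, FreeGroup.lift_apply_of]
      rw [mul_inv_eq_one]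
      refine Units.ext (Subalgebra.matrix_map_coe_injective ?_)
      simp only [Units.val_mul, hu, Subalgebra.matrix_map_coe_mul, hM]
      rw [hmul, hmul, (drinfeldElement_commute c Φ hij).eq]
  refine ⟨PresentedGroup.toGroup hrel, fun i => ?_, fun R hR => ?_⟩
  · rw [BraidGroup.sigma, PresentedGroup.toGroup.of, hu, hM]
  · refine PresentedGroup.ext fun i => ?_
    rw [PresentedGroup.toGroup.of]
    exact Units.ext (Subalgebra.matrix_map_coe_injective ((hR i).trans (hM i).symm))

end Lift

/-! ### Anti-automorphisms -/

section AntiSeries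

open MulOpposite

variable {k R : Type*} [CommRing k] [Ring R] [Algebra k R]

/-- The extension of the anti-endomorphism `τ` of `R` to series, with `h` sent to `δ h`. -/
noncomputable def antiSeries (τ : R →ₐ[k] Rᵐᵒᵖ) (δ : k) (f : R⟦X⟧) : R⟦X⟧ :=
  PowerSeries.mk fun d => δ ^ d • unop (τ (PowerSeries.coeff d f))

theorem coeff_antiSeries (τ : R →ₐ[k] Rᵐᵒᵖ) (δ : k) (f : R⟦X⟧) (d : ℕ) :
    PowerSeries.coeff d (antiSeries τ δ f) = δ ^ d • unop (τ (PowerSeries.coeff d f)) :=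
  PowerSeries.coeff_mk _ _

theorem antiSeries_mul (τ : R →ₐ[k] Rᵐᵒᵖ) (δ : k) (f g : R⟦X⟧) :
    antiSeries τ δ (f * g) = antiSeries τ δ g * antiSeries τ δ f := by
  ext d
  rw [coeff_antiSeries, PowerSeries.coeff_mul, PowerSeries.coeff_mul,
    ← Finset.Nat.sum_antidiagonal_swap, map_sum, Finset.unop_sum, Finset.smul_sum]
  refine Finset.sum_congr rfl fun p hp => ?_
  rw [Finset.HasAntidiagonal.mem_antidiagonal] at hp
  rw [coeff_antiSeries, coeff_antiSeries, smul_mul_smul_comm, ← pow_add, hp, map_mul, unop_mul]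
  rfl

theorem antiSeries_C (τ : R →ₐ[k] Rᵐᵒᵖ) (δ : k) (u : R) :
    antiSeries τ δ (PowerSeries.C u) = PowerSeries.C (unop (τ u)) := by
  ext d
  rw [coeff_antiSeries, PowerSeries.coeff_C, PowerSeries.coeff_C]
  split_ifs with h <;> simp [h]

end AntiSeries

/-! ### Skew elements and the inversion of Drinfeld's elements -/

section AntiAssociator

open MulOpposite

variable {k R : Type*} [Field k] [Ring R] [Algebra k R] {c : k} {Φ : NCSeries k}

/-- The hypotheses say that `h x` and `h y` are skew once `h` goes to `δ h`. By homogeneity `δ ^ d`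
enters the arguments, and `antiSeries` then agrees with the antipode on this value of `Φ`. -/
theorem IsAssociator.antiSeries_eval_mul (hΦ : IsAssociator c Φ) {τ : R →ₐ[k] Rᵐᵒᵖ} {δ : k}
    {x y : R} (hx : δ • τ x = op (-x)) (hy : δ • τ y = op (-y)) :
    antiSeries τ δ (Φ.eval x y) * Φ.eval x y = 1 := by
  rw [← hΦ.antipode x y]
  congr 1
  ext d
  rw [coeff_antiSeries, PowerSeries.coeff_mk, ← hx, ← hy, Φ.coeff_eval_smul, Φ.coeff_eval_map,
    unop_smul]

theorem antiSeries_hExp_mul [CharZero k] {τ : R →ₐ[k] Rᵐᵒᵖ} {δ : k} {x : R}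
    (hx : δ • τ x = op (-x)) : antiSeries τ δ (hExp k x) * hExp k x = 1 := by
  rw [← hExp_neg_mul_self (k := k) x]
  congr 1
  ext d
  rw [coeff_antiSeries, coeff_hExp, coeff_hExp, map_smul, map_pow, unop_smul, smul_comm,
    ← unop_smul, ← smul_pow, hx, unop_pow, unop_op]

/-- The images of the Artin generators are unitary for every anti-automorphism for which the
permutations are unitary and the generators `h t_{ij}` are skew. -/
theorem IsAssociator.antiSeries_map_drinfeldElement_mul [CharZero k] {n : ℕ}
    (hΦ : IsAssociator c Φ) {τ : R →ₐ[k] Rᵐᵒᵖ} {δ : k} (ρ : InfBraid k n →ₐ[k] R)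
    (ht : ∀ i j, δ • τ (ρ (InfBraid.t k i j)) = op (-ρ (InfBraid.t k i j)))
    (hs : ∀ s, unop (τ (ρ (InfBraid.perm k s))) * ρ (InfBraid.perm k s) = 1) (i : Fin (n - 1)) :
    antiSeries τ δ (PowerSeries.map (ρ : InfBraid k n →+* R) (drinfeldElement c Φ i)) *
      PowerSeries.map (ρ : InfBraid k n →+* R) (drinfeldElement c Φ i) = 1 := by
  have hY : ∀ r, δ • τ (ρ (InfBraid.Y k r)) = op (-ρ (InfBraid.Y k r)) := by
    intro r
    rw [InfBraid.Y, map_sum, map_sum, Finset.smul_sum, ← Finset.sum_neg_distrib, Finset.op_sum]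
    exact Finset.sum_congr rfl fun j _ => ht j r
  have hct : ∀ i j, δ • τ (c • ρ (InfBraid.t k i j)) = op (-(c • ρ (InfBraid.t k i j))) := by
    intro i j
    rw [map_smul, smul_comm, ht, ← op_smul, smul_neg]
  have cancel : ∀ {u v : R⟦X⟧}, u * v = 1 → ∀ w, u * (v * w) = w := by
    intro u v h w
    rw [← mul_assoc, h, one_mul]
  have hC : PowerSeries.map (ρ : InfBraid k n →+* R)
      (PowerSeries.C (InfBraid.perm k (Equiv.swap (strandLeft i) (strandRight i)))) =
      PowerSeries.C (ρ (InfBraid.perm k (Equiv.swap (strandLeft i) (strandRight i)))) :=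
    PowerSeries.map_C _ _
  have hCC : ∀ s, PowerSeries.C (unop (τ (ρ (InfBraid.perm k s)))) *
      PowerSeries.C (ρ (InfBraid.perm k s)) = 1 := fun s => by
    rw [← map_mul, hs, map_one]
  simp only [drinfeldElement, map_mul, Φ.map_eval, map_hExp, map_smul, hC, antiSeries_mul,
    antiSeries_C, mul_assoc]
  rw [cancel (hΦ.antiSeries_eval_mul (ht _ _) (hY _)), cancel (hCC _),
    cancel (antiSeries_hExp_mul (hct _ _)), hΦ.antiSeries_eval_mul (hY _) (ht _ _)]

/-- Every `t_{ij}` is skew as soon as `t_{12}` is. -/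
theorem InfBraid.skew_t_of_skew_t12 {n : ℕ} (hn : 2 ≤ n) {τ : R →ₐ[k] Rᵐᵒᵖ} {δ : k}
    (ρ : InfBraid k n →ₐ[k] R)
    (ht : δ • τ (ρ (InfBraid.t12 k hn)) = op (-ρ (InfBraid.t12 k hn)))
    (hs : ∀ s, unop (τ (ρ (InfBraid.perm k s))) * ρ (InfBraid.perm k s) = 1) (i j : Fin n) :
    δ • τ (ρ (InfBraid.t k i j)) = op (-ρ (InfBraid.t k i j)) := by
  by_cases hij : i = j
  · simp [hij, t_self]
  have hinv : ∀ s : Equiv.Perm (Fin n), perm k s * perm k s⁻¹ = 1 := fun s => by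
    rw [← perm_mul, mul_inv_cancel, perm_one]
  have hτ : ∀ s, τ (ρ (perm k s)) = op (ρ (perm k s⁻¹)) := by
    intro s
    refine unop_injective ?_
    have h := hs s
    rw [← mul_one (unop _), ← map_one ρ, ← hinv s, map_mul, ← mul_assoc, h, one_mul, unop_op]
  let a : Fin n := ⟨0, by omega⟩
  let b : Fin n := ⟨1, by omega⟩
  have hab : a ≠ b := by simp [a, b]
  -- The first transposition takes `a` to `i`; the second brings the image of `b` to `j` and leaves
  -- `i` in place.
  let s : Equiv.Perm (Fin n) := Equiv.swap (Equiv.swap a i b) j * Equiv.swap a i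
  have hsa : s a = i := by
    have h : i ≠ Equiv.swap a i b := fun h => hab ((Equiv.swap a i).injective
      (by rw [← h, Equiv.swap_apply_left]))
    simp only [s, Equiv.Perm.mul_apply, Equiv.swap_apply_left]
    exact Equiv.swap_apply_of_ne_of_ne h hij
  have hsb : s b = j := by simp [s]
  have htij : t k i j = perm k s * t12 k hn * perm k s⁻¹ := by
    have h := semiconjBy_perm_t (k := k) s a b
    rw [hsa, hsb] at h
    rw [t12, h.eq, mul_assoc, hinv, mul_one]
  rw [htij, map_mul, map_mul, map_mul, map_mul, hτ, hτ, inv_inv, ← smul_mul_assoc,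
    ← mul_smul_comm, ht, ← op_mul, ← op_mul]
  simp [mul_assoc]

end AntiAssociator

/-! ### Isometries -/

section Gram

variable {k : Type*} [Field k] {N : ℕ}

theorem formTranspose_one (β : LinearMap.BilinForm k (Fin N → k))
    (hβ : IsUnit (LinearMap.BilinForm.toMatrix' β).det) : formTranspose β 1 = 1 := by
  rw [formTranspose, Matrix.transpose_one, Matrix.mul_one, Matrix.nonsing_inv_mul _ hβ]

theorem formTranspose_mul (β : LinearMap.BilinForm k (Fin N → k))
    (hβ : IsUnit (LinearMap.BilinForm.toMatrix' β).det) (x y : Matrix (Fin N) (Fin N) k) :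
    formTranspose β (x * y) = formTranspose β y * formTranspose β x := by
  simp only [formTranspose, Matrix.transpose_mul, Matrix.mul_assoc]
  rw [Matrix.mul_nonsing_inv_cancel_left _ _ hβ]

theorem formTranspose_add (β : LinearMap.BilinForm k (Fin N → k))
    (x y : Matrix (Fin N) (Fin N) k) :
    formTranspose β (x + y) = formTranspose β x + formTranspose β y := by
  simp only [formTranspose, Matrix.transpose_add, Matrix.mul_add, Matrix.add_mul]

theorem formTranspose_smul (β : LinearMap.BilinForm k (Fin N → k)) (r : k)
    (x : Matrix (Fin N) (Fin N) k) : formTranspose β (r • x) = r • formTranspose β x := by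
  simp only [formTranspose, Matrix.transpose_smul, Matrix.mul_smul, Matrix.smul_mul]

open MulOpposite in
/-- The transpose as an anti-endomorphism of the algebra of matrices. -/
noncomputable def formTransposeHom (β : LinearMap.BilinForm k (Fin N → k))
    (hβ : IsUnit (LinearMap.BilinForm.toMatrix' β).det) :
    Matrix (Fin N) (Fin N) k →ₐ[k] (Matrix (Fin N) (Fin N) k)ᵐᵒᵖ :=
  AlgHom.ofLinearMap
    { toFun := fun x => op (formTranspose β x)
      map_add' := fun x y => congrArg op (formTranspose_add β x y)
      map_smul' := fun r x => congrArg op (formTranspose_smul β r x) }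
    (congrArg op (formTranspose_one β hβ))
    (fun x y => congrArg op (formTranspose_mul β hβ x y))

/-- Unitarity multiplied on the left by the Gram matrix `G`, as `G x† = xᵀ G`. Without inverses, the
identity can be read over `A` and then pushed to `K`. -/
theorem gram_drinfeldMatrix [CharZero k] {n : ℕ} (hn : 2 ≤ n) {c : k} {Φ : NCSeries k}
    (hΦ : IsAssociator c Φ) (ρ : InfBraid k n →ₐ[k] Matrix (Fin N) (Fin N) k)
    (β : LinearMap.BilinForm k (Fin N → k))
    (hβ : IsUnit (LinearMap.BilinForm.toMatrix' β).det) (δ : k)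
    (ht : δ • formTranspose β (ρ (InfBraid.t12 k hn)) = -ρ (InfBraid.t12 k hn))
    (hs : PermActsByIsometries β ρ) (i : Fin (n - 1)) :
    ((drinfeldMatrix c Φ ρ i).map (PowerSeries.rescale δ)).transpose *
      (LinearMap.BilinForm.toMatrix' β).map PowerSeries.C * drinfeldMatrix c Φ ρ i =
      (LinearMap.BilinForm.toMatrix' β).map PowerSeries.C := by
  have h := hΦ.antiSeries_map_drinfeldElement_mul (τ := formTransposeHom β hβ) (δ := δ) ρ
    (InfBraid.skew_t_of_skew_t12 hn ρ (congrArg MulOpposite.op ht) hs) hs i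
  rw [drinfeldMatrix]
  set f := PowerSeries.map (ρ : InfBraid k n →+* Matrix (Fin N) (Fin N) k) (drinfeldElement c Φ i)
  have key : ((seriesMatrix f).map (PowerSeries.rescale δ)).transpose =
      seriesMatrix (PowerSeries.mk fun d => δ ^ d • (PowerSeries.coeff d f).transpose) := by
    ext a b d
    simp [seriesMatrix, PowerSeries.coeff_rescale]
  have hG : (PowerSeries.mk fun d => δ ^ d • (PowerSeries.coeff d f).transpose) *
      PowerSeries.C (LinearMap.BilinForm.toMatrix' β) =
      PowerSeries.C (LinearMap.BilinForm.toMatrix' β) *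
        antiSeries (formTransposeHom β hβ) δ f := by
    ext1 d
    rw [PowerSeries.coeff_mul_C, PowerSeries.coeff_C_mul, PowerSeries.coeff_mk, coeff_antiSeries]
    change _ = _ * (δ ^ d • formTranspose β (PowerSeries.coeff d f))
    rw [formTranspose, mul_smul_comm, smul_mul_assoc, Matrix.mul_assoc,
      Matrix.mul_nonsing_inv_cancel_left _ _ hβ]
  rw [key, ← seriesMatrix_C, ← seriesMatrix_mul, ← seriesMatrix_mul, hG, mul_assoc, h, mul_one]

theorem BraidGroup.induction {n : ℕ} {p : BraidGroup n → Prop} (one : p 1)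
    (mul : ∀ g g', p g → p g' → p (g * g')) (inv : ∀ g, p g → p g⁻¹)
    (sigma : ∀ i, p (BraidGroup.sigma i)) (g : BraidGroup n) : p g := by
  have hg : g ∈ Subgroup.closure (Set.range (PresentedGroup.of (rels := braidRelators n))) := by
    rw [PresentedGroup.closure_range_of]
    trivial
  induction hg using Subgroup.closure_induction with
  | mem x hx => obtain ⟨i, rfl⟩ := hx; exact sigma i
  | one => exact one
  | mul x y _ _ hx hy => exact mul x y hx hy
  | inv x _ hx => exact inv x hx

/-- The invertible matrices preserving a form twisted by `η` are stable under products and inverses.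
-/
theorem gram_of_gram_sigma {A : Type*} [CommRing A] {n : ℕ}
    (R : BraidGroup n →* Matrix.GeneralLinearGroup (Fin N) A) (η : A →+* A)
    (G : Matrix (Fin N) (Fin N) A)
    (h : ∀ i, ((R (BraidGroup.sigma i)).1.map η).transpose * G * (R (BraidGroup.sigma i)).1 = G)
    (g : BraidGroup n) : ((R g).1.map η).transpose * G * (R g).1 = G := by
  induction g using BraidGroup.induction with
  | one => simp [Matrix.map_one]
  | mul g g' hg hg' =>
    rw [map_mul, Units.val_mul, Matrix.map_mul, Matrix.transpose_mul]
    calc _ = ((R g').1.map η).transpose * (((R g).1.map η).transpose * G * (R g).1) *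
          (R g').1 := by simp only [Matrix.mul_assoc]
      _ = G := by rw [hg, hg']
  | inv g hg =>
    have h₁ : (R g).1 * (R g⁻¹).1 = 1 := by
      rw [← Units.val_mul, ← map_mul, mul_inv_cancel, map_one, Units.val_one]
    have h₂ : ((R g⁻¹).1.map η).transpose * ((R g).1.map η).transpose = 1 := by
      rw [← Matrix.transpose_mul, ← Matrix.map_mul, h₁, Matrix.map_one _ (map_zero _) (map_one _),
        Matrix.transpose_one]
    calc _ = ((R g⁻¹).1.map η).transpose * (((R g).1.map η).transpose * G * (R g).1) *
          (R g⁻¹).1 := by rw [hg]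
      _ = (((R g⁻¹).1.map η).transpose * ((R g).1.map η).transpose) * G *
          ((R g).1 * (R g⁻¹).1) := by simp only [Matrix.mul_assoc]
      _ = G := by rw [h₁, h₂, one_mul, mul_one]
  | sigma i => exact h i

/-- Passage from an identity between Gram matrices over `A` to the form over `K`. -/
theorem formTranspose_map_mul_of_gram {A K : Type*} [CommRing A] [Field K] (ι : k →+* A)
    (φ : A →+* K) (η : A →+* A) (ε : K →+* K) (hε : ∀ f, ε (φ f) = φ (η f))
    (hη : ∀ r, η (ι r) = ι r) (β : LinearMap.BilinForm k (Fin N → k))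
    (hβ : IsUnit (LinearMap.BilinForm.toMatrix' β).det) (M : Matrix (Fin N) (Fin N) A)
    (hM : (M.map η).transpose * (LinearMap.BilinForm.toMatrix' β).map ι * M =
      (LinearMap.BilinForm.toMatrix' β).map ι) :
    (formTranspose (extendForm (φ.comp ι) β) (M.map φ)).map ε * M.map φ = 1 := by
  rw [formTranspose, extendForm, LinearMap.BilinForm.toMatrix'_toBilin']
  set G := (LinearMap.BilinForm.toMatrix' β).map (φ.comp ι)
  have hG : IsUnit G.det := by
    have := hβ.map (φ.comp ι)
    rwa [RingHom.map_det] at this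
  have hGε : G.map ε = G := by
    ext a b
    simp [G, hε, hη]
  have hMε : (M.map φ).transpose.map ε = (M.map η).transpose.map φ := by
    ext a b
    simp [hε]
  have hinv : G⁻¹.map ε * G = 1 := by
    have h := congrArg (fun X => X.map ε) (Matrix.nonsing_inv_mul G hG)
    simpa only [Matrix.map_mul, hGε, Matrix.map_one ε (map_zero ε) (map_one ε)] using h
  have hGA : ((LinearMap.BilinForm.toMatrix' β).map ι).map φ = G := rfl
  have hM' := congrArg (fun X => X.map φ) hM
  simp only [Matrix.map_mul, hGA] at hM'
  rw [Matrix.map_mul, Matrix.map_mul, hGε, hMε, Matrix.mul_assoc, Matrix.mul_assoc,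
    ← Matrix.mul_assoc (Matrix.map _ φ), hM', hinv]

end Gram

/-! ### Isometries over the quotient field -/

section Main

variable {k : Type*} [Field k] [CharZero k] {n N : ℕ} {c : k} {Φ : NCSeries k}
  {A : Subalgebra k k⟦X⟧}

theorem gram_drinfeldLift (hn : 2 ≤ n) (hΦ : IsAssociator c Φ)
    (ρ : InfBraid k n →ₐ[k] Matrix (Fin N) (Fin N) k)
    (R : BraidGroup n →* Matrix.GeneralLinearGroup (Fin N) A) (hR : IsDrinfeldLift c Φ ρ R)
    (β : LinearMap.BilinForm k (Fin N → k))
    (hβ : IsUnit (LinearMap.BilinForm.toMatrix' β).det) (δ : k)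
    (ht : δ • formTranspose β (ρ (InfBraid.t12 k hn)) = -ρ (InfBraid.t12 k hn))
    (hs : PermActsByIsometries β ρ) (η : A →+* A)
    (hη : ∀ f, (η f : k⟦X⟧) = PowerSeries.rescale δ (f : k⟦X⟧)) (g : BraidGroup n) :
    ((R g).1.map η).transpose * (LinearMap.BilinForm.toMatrix' β).map (algebraMap k A) *
      (R g).1 = (LinearMap.BilinForm.toMatrix' β).map (algebraMap k A) := by
  refine gram_of_gram_sigma R η _ (fun i => Subalgebra.matrix_map_coe_injective ?_) g
  have hG : ((LinearMap.BilinForm.toMatrix' β).map (algebraMap k A)).map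
      (fun f : A => (f : k⟦X⟧)) = (LinearMap.BilinForm.toMatrix' β).map PowerSeries.C := rfl
  have hM : ((R (BraidGroup.sigma i)).1.map η).transpose.map (fun f : A => (f : k⟦X⟧)) =
      (((R (BraidGroup.sigma i)).1.map (fun f : A => (f : k⟦X⟧))).map
        (PowerSeries.rescale δ)).transpose := by
    ext1 a b
    exact hη _
  simp only [Subalgebra.matrix_map_coe_mul, hG, hM]
  rw [hR i]
  exact gram_drinfeldMatrix hn hΦ ρ β hβ δ ht hs i

/-- The case `δ = 1`, where `h` is fixed and `t_{12}` itself is skew; it serves the orthogonal and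
the symplectic statement alike. -/
theorem map_drinfeldLift_mem_isometries (hn : 2 ≤ n) (hΦ : IsAssociator c Φ)
    (ρ : InfBraid k n →ₐ[k] Matrix (Fin N) (Fin N) k)
    (R : BraidGroup n →* Matrix.GeneralLinearGroup (Fin N) A) (hR : IsDrinfeldLift c Φ ρ R)
    (β : LinearMap.BilinForm k (Fin N → k)) (hβ : β.Nondegenerate)
    (ht : formTranspose β (ρ (InfBraid.t12 k hn)) = -ρ (InfBraid.t12 k hn))
    (hs : PermActsByIsometries β ρ) (K : Type*) [Field K] [Algebra A K] (g : BraidGroup n) :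
    Matrix.GeneralLinearGroup.map (algebraMap A K) (R g) ∈
      isometries (extendForm ((algebraMap A K).comp (algebraMap k A)) β) := by
  have hdet : IsUnit (LinearMap.BilinForm.toMatrix' β).det :=
    isUnit_iff_ne_zero.mpr <| Matrix.nondegenerate_iff_det_ne_zero.mp <|
      LinearMap.BilinForm.nondegenerate_toMatrix'_iff.mpr hβ
  have h := formTranspose_map_mul_of_gram (algebraMap k A) (algebraMap A K) (RingHom.id A)
    (RingHom.id K) (fun _ => rfl) (fun _ => rfl) β hdet _
    (gram_drinfeldLift hn hΦ ρ R hR β hdet 1 (by rwa [one_smul]) hs (RingHom.id A)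
      (fun f => by simp) g)
  exact h

/-- The case `δ = -1`: `t_{12}` is self-adjoint, and the sign change of `h` makes `h t_{12}` skew.
-/
theorem map_drinfeldLift_mem_formalUnitaryGroup (hn : 2 ≤ n) (hΦ : IsAssociator c Φ)
    (ρ : InfBraid k n →ₐ[k] Matrix (Fin N) (Fin N) k) (hA : IsDiscreteValuationSubring A)
    (R : BraidGroup n →* Matrix.GeneralLinearGroup (Fin N) A) (hR : IsDrinfeldLift c Φ ρ R)
    (β : LinearMap.BilinForm k (Fin N → k)) (hβ : β.Nondegenerate)
    (ht : formTranspose β (ρ (InfBraid.t12 k hn)) = ρ (InfBraid.t12 k hn))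
    (hs : PermActsByIsometries β ρ) (K : Type*) [Field K] [Algebra A K] [IsFractionRing A K]
    (g : BraidGroup n) :
    Matrix.GeneralLinearGroup.map (algebraMap A K) (R g) ∈
      formalUnitaryGroup (epsilonField hA K)
        (extendForm ((algebraMap A K).comp (algebraMap k A)) β) := by
  have hdet : IsUnit (LinearMap.BilinForm.toMatrix' β).det :=
    isUnit_iff_ne_zero.mpr <| Matrix.nondegenerate_iff_det_ne_zero.mp <|
      LinearMap.BilinForm.nondegenerate_toMatrix'_iff.mpr hβ
  have hC : ∀ r : k, PowerSeries.rescale (-1 : k) (PowerSeries.C r) = PowerSeries.C r := by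
    intro r
    ext d
    rw [PowerSeries.coeff_rescale, PowerSeries.coeff_C]
    split_ifs with h <;> simp [h]
  have h := formTranspose_map_mul_of_gram (algebraMap k A) (algebraMap A K)
    (epsilonSubring hA : A →+* A) (epsilonField hA K : K →+* K)
    (fun f => IsFractionRing.ringEquivOfRingEquiv_algebraMap (epsilonSubring hA) f)
    (fun r => Subtype.ext (hC r)) β hdet _
    (gram_drinfeldLift hn hΦ ρ R hR β hdet (-1) (by rw [ht, neg_one_smul]) hs
      (epsilonSubring hA : A →+* A) (fun f => rfl) g)
  exact Units.eq_inv_of_mul_eq_one_right h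

end Main

theorem mainTheorem4 {k : Type*} [Field k] [CharZero k] {n N : ℕ} (hn : 2 ≤ n)
    (c : k) (Φ : NCSeries k) (hΦ : IsAssociator c Φ)
    (ρ : InfBraid k n →ₐ[k] Matrix (Fin N) (Fin N) k)
    (A : Subalgebra k (PowerSeries k)) (hA : IsDiscreteValuationSubring A)
    (hAρ : ∀ i a b, drinfeldMatrix c Φ ρ i a b ∈ A)
    (K : Type*) [Field K] [Algebra A K] [IsFractionRing A K] :
    (∃! R : BraidGroup n →* Matrix.GeneralLinearGroup (Fin N) A, IsDrinfeldLift c Φ ρ R) ∧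
    ∀ R : BraidGroup n →* Matrix.GeneralLinearGroup (Fin N) A, IsDrinfeldLift c Φ ρ R →
      ∀ β : LinearMap.BilinForm k (Fin N → k),
        (IsOrthogonalRep hn β ρ → ∀ g : BraidGroup n,
          Matrix.GeneralLinearGroup.map (algebraMap A K) (R g) ∈
            isometries (extendForm ((algebraMap A K).comp (algebraMap k A)) β)) ∧
        (IsSymplecticRep hn β ρ → ∀ g : BraidGroup n,
          Matrix.GeneralLinearGroup.map (algebraMap A K) (R g) ∈
            isometries (extendForm ((algebraMap A K).comp (algebraMap k A)) β)) ∧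
        (IsUnitaryRep hn β ρ → ∀ g : BraidGroup n,
          Matrix.GeneralLinearGroup.map (algebraMap A K) (R g) ∈
            formalUnitaryGroup (epsilonField hA K)
              (extendForm ((algebraMap A K).comp (algebraMap k A)) β)) := by
  refine ⟨existsUnique_drinfeldLift hΦ ρ hA hAρ, fun R hR β => ⟨fun h g => ?_, fun h g => ?_,
    fun h g => ?_⟩⟩
  · exact map_drinfeldLift_mem_isometries hn hΦ ρ R hR β h.nondegenerate h.t12 h.perm K g
  · exact map_drinfeldLift_mem_isometries hn hΦ ρ R hR β h.nondegenerate h.t12 h.perm K g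
  · exact map_drinfeldLift_mem_formalUnitaryGroup hn hΦ ρ hA R hR β h.nondegenerate h.t12 h.perm
      K g
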